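/- Matroids are finite. For a matroid $\mathsf{M}$ with ground set $E$ let $\chi_{\mathsf M}(t)=\sum_{A\subseteq E}(-1)^{|A|}t^{\operatorname{rk}(E)-\operatorname{rk}(A)}$ be its characteristic polynomial, and for a flat $F$ let $\mathsf M^F$ be the restriction of $\mathsf M$ to $F$ and $\mathsf M_F$ the contraction of $\mathsf M$ by $F$. The Kazhdan–Lusztig polynomials $P_{\mathsf M}(t)\in\mathbb Z[t]$ are determined by: $P_{\mathsf M}=1$ if $\mathsf M$ is empty, $P_{\mathsf M}=0$ if $\mathsf M$ has rank $0$ and is not empty, $\deg P_{\mathsf M}<\operatorname{rk}(\mathsf M)/2$ if $\operatorname{rk}(\mathsf M)>0$, and $t^{\operatorname{rk}(\mathsf M)}P_{\mathsf M}(t^{-1})=\sum_F\chi_{\mathsf M^F}(t)P_{\mathsf M_F}(t)$, the sum being over all flats $F$ of $\mathsf M$. A hyperplane $H$ of a matroid $\mathsf M$ of rank $k$ is stressed if all subsets of $H$ of cardinality $k$ are circuits; its relaxation $\widetilde{\mathsf M}$ is the matroid on the same ground set whose bases are the bases of $\mathsf M$ and all subsets of $H$ of cardinality $k$. For integers $a,b\ge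 2$ and $i\ge 1$ consider the skew shape whose left-most column has $a$ boxes, followed by $i-1$ columns with two boxes and by a right-most column with $b$ boxes, where the two top boxes of the left-most column, all boxes of the middle columns and the two bottom boxes of the right-most column form two full rows of $i+1$ boxes each. Let $\overline{\operatorname{skyt}}(a,i,b)$ be the number of fillings of its $a+2i+b-2$ boxes with the integers $1,\dots,a+2i+b-2$, each used once, that increase strictly along rows from left to right and along columns from top to bottom, and that have the entry $1$ at the top of the left-most column. Put $\overline{\operatorname{skyt}}(a,i,b)=0$ if $i=0$ or $a<2$ or $b<2$. Let $k,h\ge 1$ be integers with $h\ge k-1$ (a hyperplane of a rank $k$ matroid has at least $k-1$ elements). There is exactly one polynomial $p_{k,h}(t)\in\mathbb Z[t]$ such that $P_{\widetilde{\mathsf M}}(t)=P_{\mathsf M}(t)+p_{k,h}(t)$ for every matroid $\mathsf M$ of rank $k$ and every relaxation $\widetilde{\mathsf M}$ of a stressed hyperplane of cardinality $h$ of $\mathsf M$. If $k\ge 2$, then $$p_{k,h}(t)=\sum_{i=0}^{\lfloor (k-1)/2\rfloor}\overline{\operatorname{skyt}}(h-k+2,\,i,\,k-2i+1)\,t^i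 ,$$ and $p_{1,h}(t)=1$. In particular, $p_{k,h}(t)$ has non-negative coefficients; it is $0$ if $k=2$ or $h=k-1$, and otherwise (that is, if $h\ge k$ and $k\ne 2$) it has degree exactly $\lfloor (k-1)/2\rfloor$. -/

import Mathlib

open Set Polynomial

universe u

namespace Matroid

/-- The rank of `X` in `M`, as a natural number. -/
noncomputable def natRk {α : Type*} (M : Matroid α) (X : Set α) : ℕ := (M.eRk X).toNat

/-- The rank of `M`, as a natural number. -/
noncomputable def natRank {α : Type*} (M : Matroid α) : ℕ := M.eRank.toNat

/-- A hyperplane is a flat whose rank is one less than the rank of the matroid. -/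
def IsHyperplane {α : Type*} (M : Matroid α) (H : Set α) : Prop :=
  M.IsFlat H ∧ M.eRk H + 1 = M.eRank

/-- A hyperplane `H` of a matroid of rank `k` is stressed if every subset of `H` of
cardinality `k` is a circuit. -/
def IsStressedHyperplane {α : Type*} (M : Matroid α) (H : Set α) : Prop :=
  M.IsHyperplane H ∧ ∀ S ⊆ H, S.encard = M.eRank → M.IsCircuit S

/-- The bases of the relaxation of `H`: the bases of `M`, and the subsets of `H` whose
cardinality is the rank of `M`. -/
def RelaxedIsBase {α : Type*} (M : Matroid α) (H B : Set α) : Prop :=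
  M.IsBase B ∨ (B ⊆ H ∧ B.encard = M.eRank)

theorem IsStressedHyperplane.exchangeProperty {α : Type*} {M : Matroid α} [M.Finite]
    {H : Set α} (hH : M.IsStressedHyperplane H) :
    Matroid.ExchangeProperty (M.RelaxedIsBase H) := by
  intro B₁ B₂ h₁ h₂ x hx
  have hrfin : M.eRank ≠ ⊤ := (eRank_ne_top_iff M).2 inferInstance
  have card : ∀ {B}, M.RelaxedIsBase H B → B.encard = M.eRank := by
    rintro B (h | h)
    · exact h.encard_eq_eRank
    · exact h.2
  have hI : M.Indep (B₁ \ {x}) := by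
    rcases h₁ with h | h
    · exact h.indep.sdiff _
    · exact (hH.2 B₁ h.1 h.2).sdiff_singleton_indep hx.1
  have hIcard : (B₁ \ {x}).encard + 1 = M.eRank := by
    rw [encard_sdiff_singleton_add_one hx.1, card h₁]
  have hIfin : (B₁ \ {x}).encard ≠ ⊤ := by
    intro h
    rw [h] at hIcard
    exact hrfin (by simpa using hIcard.symm)
  by_cases hcl : B₂ ⊆ M.closure (B₁ \ {x})
  · have hrk : M.eRk B₂ ≤ (B₁ \ {x}).encard := by
      rw [← hI.eRk_eq_encard, ← eRk_closure_eq M (B₁ \ {x})]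
      exact M.eRk_mono hcl
    rcases h₂ with h | h
    · rw [h.eRk_eq_eRank, ← hIcard] at hrk
      exact absurd hrk (not_le.2 ((ENat.lt_add_one_iff hIfin).2 le_rfl))
    · have hC := (hH.2 B₂ h.1 h.2).eRk_add_one_eq
      rw [h.2] at hC
      have hHr : M.eRk H = M.eRk B₂ :=
        (ENat.add_left_injective_of_ne_top (by simp : (1 : ℕ∞) ≠ ⊤)) (hH.1.2.trans hC.symm)
      have hIr : (B₁ \ {x}).encard = M.eRk B₂ :=
        (ENat.add_left_injective_of_ne_top (by simp : (1 : ℕ∞) ≠ ⊤)) (hIcard.trans hC.symm)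
      have e1 : M.closure B₂ = M.closure H :=
        (M.isRkFinite_set B₂).closure_eq_closure_of_subset_of_eRk_ge_eRk h.1 hHr.le
      have e2 : M.closure B₂ = M.closure (M.closure (B₁ \ {x})) :=
        (M.isRkFinite_set B₂).closure_eq_closure_of_subset_of_eRk_ge_eRk hcl
          (by rw [eRk_closure_eq, hI.eRk_eq_encard, hIr])
      have hIH : B₁ \ {x} ⊆ H := by
        have := M.subset_closure (B₁ \ {x}) hI.subset_ground
        rwa [← M.closure_closure, ← e2, e1, hH.1.1.closure] at this
      obtain ⟨y, hy⟩ : (B₂ \ B₁).Nonempty := by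
        rw [nonempty_iff_ne_empty, Ne, sdiff_eq_empty]
        intro hsub
        have hfin : B₂.Finite := by
          rw [← encard_ne_top_iff, h.2]; exact hrfin
        have := hfin.eq_of_subset_of_encard_le hsub (by rw [card h₁, h.2])
        exact hx.2 (this ▸ hx.1)
      refine ⟨y, hy, Or.inr ⟨insert_subset (h.1 hy.1) hIH, ?_⟩⟩
      rw [encard_insert_of_notMem (fun hyI => hy.2 hyI.1), hIcard]
  · obtain ⟨y, hy, hycl⟩ := not_subset.1 hcl
    have hB₂E : B₂ ⊆ M.E := by
      rcases h₂ with h | h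
      · exact h.subset_ground
      · exact h.1.trans hH.1.1.subset_ground
    have hyI : y ∉ B₁ \ {x} := fun h => hycl (M.subset_closure _ hI.subset_ground h)
    have hyB₁ : y ∉ B₁ := fun h => hyI ⟨h, fun hyx => hx.2 (by rw [← (show y = x from hyx)]; exact hy)⟩
    have hins : M.Indep (insert y (B₁ \ {x})) :=
      (hI.insert_indep_iff_of_notMem hyI).2 ⟨hB₂E hy, hycl⟩
    refine ⟨y, ⟨hy, hyB₁⟩, Or.inl ?_⟩
    refine hins.isBase_of_eRk_ge (M.set_finite _ hins.subset_ground) ?_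
    rw [hins.eRk_eq_encard, encard_insert_of_notMem hyI, hIcard]

/-- The relaxation of the stressed hyperplane `H` of the finite matroid `M`: the matroid on the
same ground set whose bases are those of `M` together with all subsets of `H` of cardinality
`rk M`. -/
def relax {α : Type*} (M : Matroid α) [M.Finite] (H : Set α) (hH : M.IsStressedHyperplane H) :
    Matroid α :=
  Matroid.ofIsBaseOfFinite M.ground_finite (M.RelaxedIsBase H)
    (M.exists_isBase.imp fun _ h => Or.inl h) hH.exchangeProperty
    (by
      rintro B (h | h)
      · exact h.subset_ground
      · exact h.1.trans hH.1.1.subset_ground)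

instance relax_finite {α : Type*} (M : Matroid α) [M.Finite] (H : Set α)
    (hH : M.IsStressedHyperplane H) : (M.relax H hH).Finite :=
  ⟨M.ground_finite⟩

/-- The characteristic polynomial
`χ_M(t) = ∑_{A ⊆ E} (-1)^|A| t^(rk M - rk A) = (-1)^(rk M) T_M(1 - t, 0)` of a finite matroid.
It vanishes if `M` has a loop; otherwise it is the characteristic polynomial of the lattice of
flats of `M`, see `charPoly_eq_finsum_moebius`. -/
noncomputable def charPoly {α : Type*} (M : Matroid α) : ℤ[X] :=
  ∑ᶠ A ∈ 𝒫 M.E, (-1) ^ A.ncard * X ^ (M.natRank - M.natRk A)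

theorem charPoly_eq_zero {α : Type*} (M : Matroid α) [M.Finite] {e : α} (he : M.IsLoop e) :
    charPoly M = 0 := by
  classical
  have hfin : (𝒫 M.E).Finite := M.ground_finite.finite_subsets
  rw [charPoly, finsum_mem_eq_finite_toFinset_sum _ hfin]
  have hrk : ∀ A, M.natRk (insert e A) = M.natRk A := fun A => by
    rw [natRk, natRk, ← union_singleton, M.eRk_eq_eRk_union_eRk_le_zero A he.eRk_eq.le]
  have key : ∀ A : Set α, A.Finite → e ∉ A →
      ((-1) ^ A.ncard * X ^ (M.natRank - M.natRk A) : ℤ[X]) +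
        (-1) ^ (insert e A).ncard * X ^ (M.natRank - M.natRk (insert e A)) = 0 := by
    intro A hA heA
    rw [hrk, ncard_insert_of_notMem heA hA, pow_succ]
    ring
  refine Finset.sum_involution (fun A _ => if e ∈ A then A \ {e} else insert e A) ?_ ?_ ?_ ?_
  · intro A hA
    have hA' : A ⊆ M.E := by simpa using hA
    have hAf : A.Finite := M.ground_finite.subset hA'
    split_ifs with h
    · have := key (A \ {e}) hAf.sdiff (by simp)
      rw [insert_sdiff_singleton, insert_eq_of_mem h] at this
      rw [add_comm]; exact this
    · exact key A hAf h
  · intro A _ _ hAe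
    split_ifs at hAe with h
    · rw [← hAe] at h; exact h.2 rfl
    · exact h (hAe ▸ mem_insert e A)
  · intro A hA
    have hA' : A ⊆ M.E := by simpa using hA
    split_ifs
    · exact (Finite.mem_toFinset _).2 (sdiff_subset.trans hA')
    · simpa using insert_subset he.mem_ground hA'
  · intro A _
    by_cases h : e ∈ A
    · simp [h]
    · simp [h]

/-- The characteristic polynomial of a loopless matroid is that of its lattice of flats, that is
`∑_F μ(∅, F) t^(rk M - rk F)`, where `μ(∅, ·)` is the Möbius function. -/
theorem charPoly_eq_finsum_moebius {α : Type*} (M : Matroid α) [M.Finite] [M.Loopless]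
    (μ : Set α → ℤ)
    (hμ : ∀ G, M.IsFlat G → ∑ᶠ F ∈ {F | M.IsFlat F ∧ F ⊆ G}, μ F = if G = ∅ then 1 else 0) :
    charPoly M = ∑ᶠ F ∈ {F | M.IsFlat F}, (μ F : ℤ[X]) * X ^ (M.natRank - M.natRk F) := by
  classical
  have hfin : (𝒫 M.E).Finite := M.ground_finite.finite_subsets
  have hflat : {F | M.IsFlat F}.Finite := hfin.subset fun F hF => hF.subset_ground
  have hflat' : ∀ G, {F | M.IsFlat F ∧ F ⊆ G}.Finite := fun G => hflat.subset fun F hF => hF.1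
  let g : Set α → ℤ := fun F =>
    ∑ A ∈ hfin.toFinset.filter (fun A => M.closure A = F), (-1) ^ A.ncard
  have hg : ∀ G, M.IsFlat G →
      ∑ F ∈ (hflat' G).toFinset, g F = if G = ∅ then 1 else 0 := by
    intro G hG
    have hGf := M.ground_finite.subset hG.subset_ground
    have h1 : ∑ F ∈ (hflat' G).toFinset, g F
        = ∑ A ∈ hfin.toFinset.filter (fun A => A ⊆ G), (-1) ^ A.ncard := by
      rw [← Finset.sum_fiberwise_of_maps_to (s := hfin.toFinset.filter (fun A => A ⊆ G))
        (t := (hflat' G).toFinset) (g := fun A => M.closure A)]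
      · refine Finset.sum_congr rfl fun F hF => Finset.sum_congr ?_ fun _ _ => rfl
        have hF' : M.IsFlat F ∧ F ⊆ G := by simpa using hF
        ext A
        simp only [Finset.mem_filter, Finite.mem_toFinset, mem_powerset_iff]
        constructor
        · rintro ⟨hA, rfl⟩
          exact ⟨⟨hA, (M.subset_closure A hA).trans hF'.2⟩, rfl⟩
        · rintro ⟨⟨hA, -⟩, h⟩
          exact ⟨hA, h⟩
      · intro A hA
        have hA' : A ⊆ M.E ∧ A ⊆ G := by simpa using hA
        simpa using (M.closure_subset_closure hA'.2).trans hG.closure.subset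
    rw [h1]
    have h2 : hfin.toFinset.filter (fun A => A ⊆ G)
        = hGf.toFinset.powerset.map
          ⟨fun s : Finset α => (s : Set α), Finset.coe_injective⟩ := by
      ext A
      simp only [Finset.mem_filter, Finite.mem_toFinset, mem_powerset_iff, Finset.mem_map,
        Finset.mem_powerset, Function.Embedding.coeFn_mk]
      constructor
      · rintro ⟨-, hA⟩
        exact ⟨(hGf.subset hA).toFinset, by simpa using hA, by simp⟩
      · rintro ⟨s, hs, rfl⟩
        have : (s : Set α) ⊆ G := by
          intro x hx
          simpa using hs hx
        exact ⟨this.trans hG.subset_ground, this⟩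
    rw [h2, Finset.sum_map]
    simp only [Function.Embedding.coeFn_mk, ncard_coe_finset]
    rw [Finset.sum_powerset_neg_one_pow_card]
    simp
  have hμg : ∀ n : ℕ, ∀ F, M.IsFlat F → F.ncard = n → μ F = g F := by
    intro n
    induction n using Nat.strong_induction_on with
    | _ n ih =>
      intro F hF hn
      have hFf := M.ground_finite.subset hF.subset_ground
      have e1 := hμ F hF
      rw [finsum_mem_eq_finite_toFinset_sum _ (hflat' F), ← hg F hF] at e1
      have hmem : F ∈ (hflat' F).toFinset := by simpa using hF
      rw [← Finset.add_sum_erase _ _ hmem, ← Finset.add_sum_erase _ _ hmem] at e1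
      have e2 : ∑ G ∈ (hflat' F).toFinset.erase F, μ G
          = ∑ G ∈ (hflat' F).toFinset.erase F, g G := by
        refine Finset.sum_congr rfl fun G hG => ?_
        have hG' : G ≠ F ∧ M.IsFlat G ∧ G ⊆ F := by simpa using hG
        exact ih G.ncard (hn ▸ ncard_lt_ncard (hG'.2.2.ssubset_of_ne hG'.1) hFf) G hG'.2.1 rfl
      rw [e2] at e1
      exact add_right_cancel e1
  rw [charPoly, finsum_mem_eq_finite_toFinset_sum _ hfin,
    finsum_mem_eq_finite_toFinset_sum _ hflat,
    ← Finset.sum_fiberwise_of_maps_to (t := hflat.toFinset) (g := fun A => M.closure A)]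
  · refine Finset.sum_congr rfl fun F hF => ?_
    rw [hμg _ F (by simpa using hF) rfl]
    simp only [g, Int.cast_sum, Finset.sum_mul]
    refine Finset.sum_congr rfl fun A hA => ?_
    have hA' : M.closure A = F := (Finset.mem_filter.1 hA).2
    rw [← hA', natRk, natRk, eRk_closure_eq]
    simp
  · intro A _
    simp

/-- The truncation of a polynomial to the powers `t ^ i` with `i < r / 2`. -/
noncomputable def lowerHalf (r : ℕ) (R : ℤ[X]) : ℤ[X] :=
  ∑ i ∈ (Finset.range r).filter (fun i => 2 * i < r), monomial i (R.coeff i)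

/-- The Kazhdan–Lusztig polynomial of a finite matroid. It is the solution of
* `P_M = 1` if `M` is empty, and `P_M = 0` if `rk M = 0` and `M` is not empty;
* `deg P_M < rk M / 2` if `rk M > 0`;
* `t ^ (rk M) * P_M (t⁻¹) = ∑_F χ_{M^F} (t) * P_{M_F} (t)`, the sum being over all flats `F`.

If `∅` is a flat, it contributes `P_M` to the last sum, so that the sum `R` over the flats
`F ≠ ∅` is `t ^ (rk M) * P_M (t⁻¹) - P_M`, where the first term has only powers of `t` beyond
`rk M / 2`, and `P_M` is minus the lower half of `R`. If `∅` is not a flat, `R = 0 = P_M`.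
Here `M^F` is the restriction `M ↾ F` and `M_F` the contraction `M ／ F`.
See `klPoly_unique`. -/
noncomputable def klPoly {α : Type*} (M : Matroid α) [M.Finite] : ℤ[X] :=
  open Classical in
  if M.eRank = 0 then (if M.E = ∅ then 1 else 0)
  else - lowerHalf M.natRank
    (∑ᶠ F : {F : Set α // M.IsFlat F ∧ F.Nonempty}, charPoly (M ↾ F.1) * klPoly (M ／ F.1))
termination_by M.E.ncard
decreasing_by
  have hF := F.2.1.subset_ground
  exact ncard_lt_ncard (⟨sdiff_subset, fun h => F.2.2.elim fun x hx => (h (hF hx)).2 hx⟩) M.ground_finite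

/-- A family of polynomials that satisfies the three defining conditions of the
Kazhdan–Lusztig polynomials coincides with `klPoly`. -/
theorem klPoly_unique {α : Type*} (P : Matroid α → ℤ[X])
    (h0 : ∀ M : Matroid α, M.Finite → M.eRank = 0 →
      (M.E = ∅ → P M = 1) ∧ (M.E ≠ ∅ → P M = 0))
    (hdeg : ∀ M : Matroid α, M.Finite → M.eRank ≠ 0 → 2 * (P M).natDegree < M.natRank)
    (hrec : ∀ M : Matroid α, M.Finite → reflect M.natRank (P M) =
      ∑ᶠ F ∈ {F | M.IsFlat F}, charPoly (M ↾ F) * P (M ／ F))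
    (M : Matroid α) [hM : M.Finite] : klPoly M = P M := by
  classical
  have main : ∀ n : ℕ, ∀ M : Matroid α, ∀ _ : M.Finite, M.E.ncard = n → klPoly M = P M := by
    intro n
    induction n using Nat.strong_induction_on with
    | _ n ih =>
    intro M hM hn
    rw [klPoly]
    split_ifs with hr hE
    · exact ((h0 M hM hr).1 hE).symm
    · exact ((h0 M hM hr).2 hE).symm
    have hfin : {F | M.IsFlat F ∧ F.Nonempty}.Finite :=
      M.ground_finite.finite_subsets.subset fun F hF => hF.1.subset_ground
    have e1 : (∑ᶠ F : {F : Set α // M.IsFlat F ∧ F.Nonempty},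
          charPoly (M ↾ F.1) * klPoly (M ／ F.1))
        = ∑ᶠ F ∈ {F | M.IsFlat F ∧ F.Nonempty}, charPoly (M ↾ F) * P (M ／ F) := by
      rw [← finsum_set_coe_eq_finsum_mem]
      refine finsum_congr fun F => ?_
      have hF := F.2.1.subset_ground
      rw [ih (M ／ F.1).E.ncard ?_ (M ／ F.1) inferInstance rfl]
      rw [← hn]
      exact ncard_lt_ncard ⟨sdiff_subset, fun h => F.2.2.elim fun x hx => (h (hF hx)).2 hx⟩
        M.ground_finite
    rw [e1]
    by_cases h : M.IsFlat ∅
    · have hset : {F | M.IsFlat F} = insert ∅ {F | M.IsFlat F ∧ F.Nonempty} := by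
        ext F
        rcases F.eq_empty_or_nonempty with rfl | hF
        · simpa using h
        · simp [hF, hF.ne_empty]
      have hchi : charPoly (M ↾ (∅ : Set α)) = 1 := by
        rw [charPoly]
        simp [natRank, natRk]
      have hR := hrec M hM
      rw [hset, finsum_mem_insert _ (by simp) hfin, hchi, one_mul, contract_empty] at hR
      rw [← sub_eq_iff_eq_add'] at hR
      rw [← hR, lowerHalf]
      have hd := hdeg M hM hr
      ext j
      simp only [coeff_neg, finsetSum_coeff, coeff_monomial, coeff_sub]
      rw [Finset.sum_ite_eq']
      simp only [Finset.mem_filter, Finset.mem_range]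
      split_ifs with hj
      · rw [coeff_reflect, revAt_le hj.1.le,
          coeff_eq_zero_of_natDegree_lt (by omega : (P M).natDegree < M.natRank - j)]
        simp
      · rw [coeff_eq_zero_of_natDegree_lt (by omega : (P M).natDegree < j)]
        simp
    · obtain ⟨e, he⟩ : M.loops.Nonempty := by
        rw [nonempty_iff_ne_empty]
        intro hl
        apply h
        rw [isFlat_iff_closure_eq]
        exact hl
      have hz : ∀ F, M.IsFlat F → charPoly (M ↾ F) = 0 := by
        intro F hF
        have : (M ↾ F).Finite := M.restrict_finite (M.ground_finite.subset hF.subset_ground)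
        refine charPoly_eq_zero (M ↾ F) (e := e) ?_
        rw [restrict_isLoop_iff]
        exact ⟨hF.loops_subset he, Or.inl he⟩
      have hR := hrec M hM
      rw [finsum_mem_congr rfl (g := fun _ => 0) (fun F hF => by rw [hz F hF, zero_mul])] at hR
      rw [finsum_mem_congr rfl (g := fun _ => 0) (fun F hF => by rw [hz F hF.1, zero_mul])]
      simp only [finsum_mem_zero] at hR ⊢
      rw [(reflect_eq_zero_iff).1 hR]
      simp [lowerHalf]
  exact main _ M hM rfl

end Matroid

open Matroid in
/-- `p` is the polynomial by which the Kazhdan–Lusztig polynomial of any matroid of rank `k`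
changes when a stressed hyperplane of cardinality `h` is relaxed. -/
def IsKLRelaxationPoly (k h : ℕ) (p : ℤ[X]) : Prop :=
  ∀ (α : Type u) (M : Matroid α) [M.Finite] (H : Set α) (hH : M.IsStressedHyperplane H),
    M.eRank = k → H.encard = h → (M.relax H hH).klPoly = M.klPoly + p

/-- The boxes of the skew shape `Skyt(a, i, b)` for `a, b ≥ 2` and `i ≥ 1`, as pairs
(row, column), rows numbered from top to bottom and columns from left to right, both from `0`.
Column `0` has `a` boxes, columns `1, …, i - 1` have two boxes and column `i` has `b` boxes.
The two top boxes of columns `0, …, i - 1` lie in the rows of the two bottom boxes of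
column `i`. -/
def skytBoxes (a i b : ℕ) : Finset (ℕ × ℕ) :=
  (Finset.Ico (b - 2) (b - 2 + a) ×ˢ {0}) ∪ (Finset.Ico (b - 2) b ×ˢ Finset.Ico 1 i) ∪
    (Finset.range b ×ˢ {i})

/-- The legal fillings of the skew shape: each of the integers `1, …, a + 2 i + b - 2` is used
exactly once, and the values increase strictly along rows (from left to right) and along columns
(from top to bottom). -/
def Skyt (a i b : ℕ) : Set (skytBoxes a i b → Finset.Icc 1 (a + 2 * i + b - 2)) :=
  {T | Function.Bijective T ∧
    (∀ c d : skytBoxes a i b, c.1.1 = d.1.1 → c.1.2 < d.1.2 → T c < T d) ∧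
    (∀ c d : skytBoxes a i b, c.1.2 = d.1.2 → c.1.1 < d.1.1 → T c < T d)}

/-- The legal fillings that have the entry `1` at the top of the left-most column. -/
def SkytBar (a i b : ℕ) : Set (skytBoxes a i b → Finset.Icc 1 (a + 2 * i + b - 2)) :=
  {T | T ∈ Skyt a i b ∧ ∀ c : skytBoxes a i b, c.1 = (b - 2, 0) → (T c : ℕ) = 1}

/-- The number of restricted skew Young tableaux, with the convention that it is `0` if `i = 0`
or if `a` or `b` is less than `2`. -/
noncomputable def skytBar (a i b : ℕ) : ℕ :=
  if i = 0 ∨ a < 2 ∨ b < 2 then 0 else (SkytBar a i b).ncard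

/-! The recursion makes P_M minus the lower half of the sum of χ_{M|A} P_{M/A} over nonempty A. Here
A may range over all subsets of the ground set, since M/A has a loop, hence zero polynomial, when A
is not a flat. Relaxing a stressed hyperplane H with k + d elements changes few terms
(`klPoly_relax_term`). A subset of H with fewer than k elements is independent, so its restriction
is Boolean and its contraction relaxes a stressed hyperplane of smaller rank with the same d. Larger
subsets of H matter only through A = H, and among sets not inside H only A = E matters. By induction
on k the total change is a binomial convolution of the p_r plus the explicit difference computed in
`charPoly_relax`. What remains is an identity free of matroids, `binomialShift_klRelaxPoly`.

Binomial transforms compose by adding their parameters, so this identity is equivalent to the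
statement that the sum of binom(k+d, j) t^j p_{k-j} is palindromic up to t^(k-1) - t
(`binomialShift_X_klRelaxPoly`). On coefficients it becomes `sum_choose_mul_skytCoeff_sub`: an
antisymmetric weight completes a double sum over i < x to a sum over a rectangle, which factors into
known one-variable sums.

The tableaux enter through `skytBar_eq_skytCoeff`. Inclusion-exclusion on the box that joins the
right column to the rows (`skewCount_eq_sum`) expresses their number by standard tableaux of
near-hook shapes, which the hook length formula counts.

If h = k - 1, relaxation adds no bases. Uniqueness of p only needs one matroid for each pair (k, h):
a uniform matroid with a coloop added. -/

/-! ### Counting linear extensions -/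

/-- The linear extensions of the relation `R` on the finite set `S`, as functions that number
the elements of `S` by `1, …, |S|` and vanish outside of `S`. -/
def linExt {β : Type*} (R : β → β → Prop) (S : Finset β) : Set (β → ℕ) :=
  {T | BijOn T S (Icc 1 S.card) ∧ (∀ x ∉ S, T x = 0) ∧ ∀ x ∈ S, ∀ y ∈ S, R x y → T x < T y}

theorem linExt_empty {β : Type*} (R : β → β → Prop) : linExt R ∅ = {0} := by
  ext T
  simp [linExt, funext_iff]

-- The largest label sits on an element with nothing above it; deleting that element leaves a linear
-- extension of the rest.
open Classical in
theorem linExt_eq_biUnion {β : Type*} [DecidableEq β] (R : β → β → Prop) (S : Finset β) (hS : S.Nonempty) :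
    linExt R S = ⋃ x ∈ {x | x ∈ S ∧ ∀ y ∈ S, ¬ R x y},
      (fun T => Function.update T x S.card) '' linExt R (S.erase x) := by
  have hpos : 1 ≤ S.card := hS.card_pos
  ext T
  simp only [mem_iUnion, mem_ofPred_eq, mem_image, exists_prop]
  constructor
  · rintro ⟨hb, h0, hR⟩
    obtain ⟨x, hx, hTx⟩ := hb.surjOn (show S.card ∈ Icc 1 S.card from ⟨hpos, le_rfl⟩)
    have hx' : x ∈ S := hx
    refine ⟨x, ⟨hx', fun y hy hxy => ?_⟩, Function.update T x 0, ⟨?_, ?_, ?_⟩, ?_⟩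
    · have h1 := hR x hx' y hy hxy
      have h2 := (hb.mapsTo (show y ∈ (S : Set β) from hy)).2
      omega
    · have h1 := hb.sdiff_singleton hx
      have h2 : (Icc 1 S.card : Set ℕ) \ {T x} = Icc 1 (S.erase x).card := by
        rw [Finset.card_erase_of_mem hx', hTx]
        ext n
        simp only [mem_sdiff, mem_Icc, mem_singleton_iff]
        omega
      rw [h2, ← Finset.coe_erase] at h1
      refine h1.congr fun y hy => ?_
      have : y ≠ x := by
        rintro rfl
        simp at hy
      simp [this]
    · intro y hy
      by_cases hyx : y = x
      · simp [hyx]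
      · simp [hyx, h0 y fun h => hy (Finset.mem_erase.2 ⟨hyx, h⟩)]
    · intro y hy z hz hyz
      rw [Finset.mem_erase] at hy hz
      simpa [hy.1, hz.1] using hR y hy.2 z hz.2 hyz
    · simp [← hTx]
  · rintro ⟨x, ⟨hx, hmax⟩, T, ⟨hb, h0, hR⟩, rfl⟩
    have hc := Finset.card_erase_of_mem hx
    refine ⟨?_, ?_, ?_⟩
    · have h1 : BijOn (Function.update T x S.card) (S.erase x) (Icc 1 (S.erase x).card) := by
        refine hb.congr fun y hy => ?_
        have : y ≠ x := by
          rintro rfl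
          simp at hy
        simp [this]
      have h2 := h1.insert (a := x) (by simp [hc])
      rw [← Finset.coe_insert, Finset.insert_erase hx] at h2
      have h3 : insert (Function.update T x S.card x) (Icc 1 (S.erase x).card : Set ℕ)
          = Icc 1 S.card := by
        rw [hc]
        ext n
        simp only [Function.update_self, mem_insert_iff, mem_Icc]
        omega
      rwa [h3] at h2
    · intro y hy
      have hyx : y ≠ x := fun h => hy (h ▸ hx)
      simp [hyx, h0 y fun h => hy (Finset.mem_of_mem_erase h)]
    · intro y hy z hz hyz
      have hyx : y ≠ x := by
        rintro rfl
        exact hmax z hz hyz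
      have hy' : y ∈ S.erase x := Finset.mem_erase.2 ⟨hyx, hy⟩
      have h1 := (hb.mapsTo (show y ∈ ((S.erase x : Finset β) : Set β) from hy')).2
      rw [hc] at h1
      by_cases hzx : z = x
      · subst hzx
        simp only [ne_eq, hyx, not_false_eq_true, Function.update_of_ne, Function.update_self]
        omega
      · simpa [hyx, hzx] using hR y hy' z (Finset.mem_erase.2 ⟨hzx, hz⟩) hyz

theorem linExt_finite {β : Type*} (R : β → β → Prop) (S : Finset β) : (linExt R S).Finite := by
  classical
  induction hn : S.card generalizing S with
  | zero =>
    rw [Finset.card_eq_zero.1 hn, linExt_empty]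
    exact finite_singleton _
  | succ n ih =>
    rw [linExt_eq_biUnion R S (Finset.card_pos.1 (by omega))]
    refine Finite.biUnion (S.finite_toSet.subset fun x hx => hx.1) fun x hx => Finite.image _ ?_
    exact ih _ (by rw [Finset.card_erase_of_mem hx.1, hn]; rfl)

-- The pieces of the preceding union are disjoint, because the position of the largest label
-- determines the deleted element.
open Classical in
theorem linExt_ncard_eq_sum {β : Type*} [DecidableEq β] (R : β → β → Prop) (S : Finset β) (hS : S.Nonempty) :
    (linExt R S).ncard =
      ∑ x ∈ S with ∀ y ∈ S, ¬ R x y, (linExt R (S.erase x)).ncard := by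
  have hfin : {x | x ∈ S ∧ ∀ y ∈ S, ¬ R x y}.Finite := S.finite_toSet.subset fun x hx => hx.1
  rw [linExt_eq_biUnion R S hS, hfin.ncard_biUnion fun x _ => (linExt_finite _ _).image _,
    finsum_mem_eq_finite_toFinset_sum _ hfin]
  · refine Finset.sum_congr (by ext; simp) fun x hx => ?_
    refine InjOn.ncard_image fun T hT T' hT' hTT => ?_
    funext y
    by_cases hyx : y = x
    · rw [hyx, hT.2.1 x (by simp), hT'.2.1 x (by simp)]
    · simpa [hyx] using congrFun hTT y
  · intro x hx y hy hxy
    rw [Function.onFun, disjoint_left]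
    rintro T ⟨T₁, hT₁, rfl⟩ ⟨T₂, hT₂, h⟩
    have h1 := congrFun h x
    simp only [ne_eq, hxy, not_false_eq_true, Function.update_of_ne, Function.update_self] at h1
    have h2 := (hT₂.1.mapsTo (show x ∈ ((S.erase y : Finset β) : Set β) from
      Finset.mem_erase.2 ⟨hxy, hx.1⟩)).2
    rw [Finset.card_erase_of_mem hy.1, h1] at h2
    have := Finset.card_pos.2 hS
    omega

/-! ### Skew shapes and removal of their corners -/

/-- The boxes of the diagram with rows `c` and `c + 1` of lengths `r₁` and `r₂`, with `e` further
boxes below the first box of row `c + 1`, and with `c'` boxes in column `i`, from row `0` on. -/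
def skewBoxes (c i r₁ r₂ e c' : ℕ) : Finset (ℕ × ℕ) :=
  {c} ×ˢ Finset.range r₁ ∪ {c + 1} ×ˢ Finset.range r₂ ∪ Finset.Ico (c + 2) (c + 2 + e) ×ˢ {0} ∪
    Finset.range c' ×ˢ {i}

theorem mem_skewBoxes {c i r₁ r₂ e c' : ℕ} {x y : ℕ} :
    (x, y) ∈ skewBoxes c i r₁ r₂ e c' ↔ (x = c ∧ y < r₁) ∨ (x = c + 1 ∧ y < r₂) ∨
      (c + 2 ≤ x ∧ x < c + 2 + e ∧ y = 0) ∨ (x < c' ∧ y = i) := by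
  simp only [skewBoxes, Finset.mem_union, Finset.mem_product, Finset.mem_singleton,
    Finset.mem_range, Finset.mem_Ico]
  tauto

/-- The relation on boxes given by the order along rows and along columns, and by making `(c, 0)`
the least box. -/
def skewRel (c : ℕ) (x y : ℕ × ℕ) : Prop :=
  (x.1 = y.1 ∧ x.2 < y.2) ∨ (x.2 = y.2 ∧ x.1 < y.1) ∨ (x = (c, 0) ∧ y ≠ x)

/-- The number of standard fillings of `skewBoxes` for which `(c, 0)` is the least box. -/
noncomputable def skewCount (c i r₁ r₂ e c' : ℕ) : ℕ :=
  (linExt (skewRel c) (skewBoxes c i r₁ r₂ e c')).ncard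

theorem skewCount_singleton (c i : ℕ) : skewCount c i 1 0 0 0 = 1 := by
  classical
  have hS : skewBoxes c i 1 0 0 0 = {(c, 0)} := by
    ext ⟨x, y⟩
    rw [mem_skewBoxes, Finset.mem_singleton, Prod.mk.injEq]
    omega
  rw [skewCount, hS, linExt_ncard_eq_sum _ _ (Finset.singleton_nonempty _)]
  rw [Finset.filter_true_of_mem (by simp [skewRel]), Finset.sum_singleton, Finset.erase_singleton,
    linExt_empty, ncard_singleton]

theorem mem_ite_singleton {β : Type*} {p : Prop} [Decidable p] {a x : β} :
    x ∈ (if p then {a} else ∅ : Finset β) ↔ p ∧ x = a := by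
  split_ifs with h <;> simp [h]

/-- The largest entry sits at the end of one of the two rows, at the foot of the first column, or at
the foot of the upper part of column `i` if row `c` does not reach that column. The hypothesis `hcc`
rules out a gap in column `i` below a nonmaximal box, so that comparing adjacent boxes detects
maximality. -/
theorem skewCount_rec {c i r₁ r₂ e c' : ℕ} (hi : 1 ≤ i) (h₁ : 1 ≤ r₁) (h₁i : r₁ ≤ i + 1)
    (h₂₁ : r₂ ≤ r₁) (he : r₂ = 0 → e = 0) (hc : c' ≤ c) (hcc : r₁ = i + 1 → c' = c)
    (hsize : 2 ≤ r₁ + r₂ + e + c') :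
    skewCount c i r₁ r₂ e c' =
      (if r₂ < r₁ ∧ 2 ≤ r₁ then skewCount c i (r₁ - 1) r₂ e c' else 0) +
      (if 1 ≤ r₂ ∧ (2 ≤ r₂ ∨ e = 0) then skewCount c i r₁ (r₂ - 1) e c' else 0) +
      (if 1 ≤ e then skewCount c i r₁ r₂ (e - 1) c' else 0) +
      (if 1 ≤ c' ∧ r₁ ≤ i then skewCount c i r₁ r₂ e (c' - 1) else 0) := by
  classical
  have hfilter : {x ∈ skewBoxes c i r₁ r₂ e c' | ∀ y ∈ skewBoxes c i r₁ r₂ e c', ¬ skewRel c x y} =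
      (if r₂ < r₁ ∧ 2 ≤ r₁ then {(c, r₁ - 1)} else ∅) ∪
      (if 1 ≤ r₂ ∧ (2 ≤ r₂ ∨ e = 0) then {(c + 1, r₂ - 1)} else ∅) ∪
      (if 1 ≤ e then {(c + 1 + e, 0)} else ∅) ∪
      (if 1 ≤ c' ∧ r₁ ≤ i then {(c' - 1, i)} else ∅) := by
    ext ⟨x, y⟩
    simp only [Finset.mem_filter, Finset.mem_union, mem_ite_singleton, Prod.mk.injEq]
    constructor
    · rintro ⟨hx, hmax⟩
      have m1 : ¬ (x + 1, y) ∈ skewBoxes c i r₁ r₂ e c' :=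
        fun h => hmax _ h (Or.inr (Or.inl ⟨rfl, Nat.lt_succ_self x⟩))
      have m2 : ¬ (x, y + 1) ∈ skewBoxes c i r₁ r₂ e c' :=
        fun h => hmax _ h (Or.inl ⟨rfl, Nat.lt_succ_self y⟩)
      -- The box `(c, 0)` may have no neighbours; it still lies below the boxes of column `i`, by
      -- the extra clause of `skewRel`.
      have m3 : ¬ ((x = c ∧ y = 0) ∧ 1 ≤ c') := by
        rintro ⟨⟨rfl, rfl⟩, h⟩
        exact hmax (0, i) (mem_skewBoxes.2 (by omega))
          (Or.inr (Or.inr ⟨rfl, by rw [Ne, Prod.mk.injEq]; omega⟩))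
      rw [mem_skewBoxes] at hx m1 m2
      rcases hx with hx | hx | hx | hx
      · exact Or.inl (Or.inl (Or.inl (by omega)))
      · exact Or.inl (Or.inl (Or.inr (by omega)))
      · exact Or.inl (Or.inr (by omega))
      · exact Or.inr (by omega)
    · intro h
      refine ⟨mem_skewBoxes.2 (by omega), fun ⟨x', y'⟩ h' hrel => ?_⟩
      rw [mem_skewBoxes] at h'
      simp only [skewRel, Prod.mk.injEq, ne_eq] at hrel
      rcases h with ((h | h) | h) | h <;> rcases hrel with hrel | hrel | hrel <;>
        rcases h' with h' | h' | h' | h' <;> omega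
  rw [skewCount, linExt_ncard_eq_sum _ _ ⟨(c, 0), mem_skewBoxes.2 (by omega)⟩, hfilter,
    Finset.sum_union, Finset.sum_union, Finset.sum_union]
  · congr 1
    · congr 1
      · congr 1
        · split_ifs
          · rw [Finset.sum_singleton, skewCount]
            congr 2
            ext ⟨x, y⟩
            simp only [Finset.mem_erase, mem_skewBoxes, ne_eq, Prod.mk.injEq]
            omega
          · rfl
        · split_ifs
          · rw [Finset.sum_singleton, skewCount]
            congr 2
            ext ⟨x, y⟩
            simp only [Finset.mem_erase, mem_skewBoxes, ne_eq, Prod.mk.injEq]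
            omega
          · rfl
      · split_ifs
        · rw [Finset.sum_singleton, skewCount]
          congr 2
          ext ⟨x, y⟩
          simp only [Finset.mem_erase, mem_skewBoxes, ne_eq, Prod.mk.injEq]
          omega
        · rfl
    · split_ifs
      · rw [Finset.sum_singleton, skewCount]
        congr 2
        ext ⟨x, y⟩
        simp only [Finset.mem_erase, mem_skewBoxes, ne_eq, Prod.mk.injEq]
        omega
      · rfl
  all_goals
    simp only [Finset.disjoint_left, Finset.mem_union, mem_ite_singleton, Prod.forall,
      Prod.mk.injEq]
    intro x y h h'
    omega

/-! ### Near-hook shapes and the hook length formula -/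

/-- The number of standard Young tableaux of shape `(r₁, r₂, 1, …, 1)` with `e` parts equal to
`1` after the first two, by the hook length formula. -/
def nearHookCount (r₁ r₂ e : ℕ) : ℚ :=
  if r₂ = 0 then 1 else
    ((r₁ + r₂ + e).factorial * (r₁ + 1 - r₂) : ℚ) /
      ((r₁ + e + 1) * (r₂ + e) * (e.factorial * r₁.factorial * (r₂ - 1).factorial))

theorem nearHookCount_pos {r₁ r₂ e : ℕ} (h : r₂ ≤ r₁) : 0 < nearHookCount r₁ r₂ e := by
  rw [nearHookCount]
  split_ifs with h0
  · exact one_pos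
  · have h1 : (0 : ℚ) < r₂ := by exact_mod_cast Nat.pos_of_ne_zero h0
    have h2 : (0 : ℚ) < r₁ + 1 - r₂ := by
      have : (r₂ : ℚ) ≤ r₁ := by exact_mod_cast h
      linarith
    positivity

theorem nearHookCount_rec {r₁ r₂ e : ℕ} (h₁ : 1 ≤ r₁) (h₂₁ : r₂ ≤ r₁) (he : r₂ = 0 → e = 0)
    (hsize : 2 ≤ r₁ + r₂ + e) :
    nearHookCount r₁ r₂ e =
      (if r₂ < r₁ ∧ 2 ≤ r₁ then nearHookCount (r₁ - 1) r₂ e else 0) +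
      (if 1 ≤ r₂ ∧ (2 ≤ r₂ ∨ e = 0) then nearHookCount r₁ (r₂ - 1) e else 0) +
      (if 1 ≤ e then nearHookCount r₁ r₂ (e - 1) else 0) := by
  obtain ⟨w, rfl⟩ : ∃ w, r₁ = w + 1 := ⟨r₁ - 1, by omega⟩
  rcases r₂ with _ | v
  · obtain rfl := he rfl
    simp [nearHookCount]
    omega
  -- Each closed form `t1`, `t2`, `t3` also covers the case of a corner that cannot be removed: the
  -- factor `w - v`, `v` or `e` is then zero.
  have t1 : (if v + 1 < w + 1 ∧ 2 ≤ w + 1 then nearHookCount (w + 1 - 1) (v + 1) e else 0) =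
      (w + 1) * (w - v) * ((w + v + 1 + e).factorial : ℚ) / ((w + e + 1) * (v + 1 + e) *
        (e.factorial * (w + 1).factorial * v.factorial)) := by
    split_ifs with h
    · rw [nearHookCount, if_neg (by omega), Nat.add_sub_cancel, Nat.add_sub_cancel,
        Nat.factorial_succ w, show w + (v + 1) + e = w + v + 1 + e by ring]
      push_cast
      field_simp
      ring
    · obtain rfl : v = w := by omega
      simp
  -- The denominators of `t2` and `t3` contain `v + e`, so the shape with a single box in its second
  -- row and none below is treated apart.
  rcases Nat.eq_zero_or_pos (v + e) with h0 | h0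
  · obtain ⟨rfl, rfl⟩ : v = 0 ∧ e = 0 := by omega
    rw [t1]
    simp only [nearHookCount, Nat.factorial_succ]
    simp
    have : (w.factorial : ℚ) ≠ 0 := by positivity
    field_simp
  have t2 : (if 1 ≤ v + 1 ∧ (2 ≤ v + 1 ∨ e = 0) then nearHookCount (w + 1) (v + 1 - 1) e else 0) =
      v * (w + 2 - v) * ((w + v + 1 + e).factorial : ℚ) / ((w + e + 2) * (v + e) *
        (e.factorial * (w + 1).factorial * v.factorial)) := by
    rcases v with _ | v
    · simp
      omega
    · rw [if_pos (by omega), nearHookCount, if_neg (by omega), Nat.add_sub_cancel,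
        Nat.add_sub_cancel, Nat.factorial_succ v,
        show w + 1 + (v + 1) + e = w + (v + 1) + 1 + e by ring]
      push_cast
      field_simp
      ring
  have t3 : (if 1 ≤ e then nearHookCount (w + 1) (v + 1) (e - 1) else 0) =
      e * (w + 1 - v) * ((w + v + 1 + e).factorial : ℚ) / ((w + e + 1) * (v + e) *
        (e.factorial * (w + 1).factorial * v.factorial)) := by
    rcases e with _ | e
    · simp
    · rw [if_pos (by omega), nearHookCount, if_neg (by omega), Nat.add_sub_cancel,
        Nat.add_sub_cancel, Nat.factorial_succ e,
        show w + 1 + (v + 1) + e = w + v + 1 + (e + 1) by ring]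
      push_cast
      field_simp
      ring
  rw [t1, t2, t3, nearHookCount, if_neg (by omega), Nat.add_sub_cancel,
    show w + 1 + (v + 1) + e = (w + v + 1 + e) + 1 by ring, Nat.factorial_succ (w + v + 1 + e)]
  have h1 : (v + e : ℚ) ≠ 0 := by exact_mod_cast h0.ne'
  push_cast
  field_simp
  ring

/-! ### Formulas for the number of skew fillings -/

/-- Row `c` stops before column `i`, so the shape is a near-hook and a separate column, tied only by
the least box. A filling is a shuffle: the column chooses its labels among all but the first. The
induction is Pascal's rule, according to which component holds the largest label. -/
theorem skewCount_eq_of_le {c i r₁ r₂ e c' : ℕ} (hi : 1 ≤ i) (h₁ : 1 ≤ r₁) (h₁i : r₁ ≤ i)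
    (h₂₁ : r₂ ≤ r₁) (he : r₂ = 0 → e = 0) (hc : c' ≤ c) :
    (skewCount c i r₁ r₂ e c' : ℚ) =
      (r₁ + r₂ + e + c' - 1).choose c' * nearHookCount r₁ r₂ e := by
  induction hs : r₁ + r₂ + e + c' generalizing r₁ r₂ e c' with
  | zero => omega
  | succ s ih =>
  rcases Nat.lt_or_ge s 1 with h | h
  · obtain ⟨rfl, rfl, rfl, rfl⟩ : r₁ = 1 ∧ r₂ = 0 ∧ e = 0 ∧ c' = 0 := by omega
    obtain rfl : s = 0 := by omega
    simp [skewCount_singleton, nearHookCount]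
  rw [skewCount_rec hi h₁ (by omega) h₂₁ he hc (by omega) (by omega)]
  have hlast : ((if 1 ≤ c' ∧ r₁ ≤ i then skewCount c i r₁ r₂ e (c' - 1) else 0 : ℕ) : ℚ) =
      (if 1 ≤ c' then ((s - 1).choose (c' - 1) : ℚ) else 0) * nearHookCount r₁ r₂ e := by
    by_cases h' : 1 ≤ c'
    · rw [if_pos ⟨h', h₁i⟩, if_pos h', ih h₁ h₁i h₂₁ he (by omega) (by omega)]
    · rw [if_neg (by omega), if_neg h']
      simp
  -- When the near-hook is only the least box, `nearHookCount_rec` does not apply, and only the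
  -- column can lose a box.
  by_cases hn : r₁ + r₂ + e = 1
  · obtain ⟨rfl, rfl, rfl⟩ : r₁ = 1 ∧ r₂ = 0 ∧ e = 0 := by omega
    rw [Nat.cast_add, hlast, if_pos (by omega : 1 ≤ c')]
    obtain ⟨c'', rfl⟩ : ∃ n, c' = n + 1 := ⟨c' - 1, by omega⟩
    obtain rfl : s = c'' + 1 := by omega
    simp
  have p1 : ((if r₂ < r₁ ∧ 2 ≤ r₁ then skewCount c i (r₁ - 1) r₂ e c' else 0 : ℕ) : ℚ) =
      (s - 1).choose c' * (if r₂ < r₁ ∧ 2 ≤ r₁ then nearHookCount (r₁ - 1) r₂ e else 0) := by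
    split_ifs with h'
    · exact ih (by omega) (by omega) (by omega) he hc (by omega)
    · simp
  have p2 : ((if 1 ≤ r₂ ∧ (2 ≤ r₂ ∨ e = 0) then skewCount c i r₁ (r₂ - 1) e c' else 0 : ℕ) : ℚ) =
      (s - 1).choose c' *
        (if 1 ≤ r₂ ∧ (2 ≤ r₂ ∨ e = 0) then nearHookCount r₁ (r₂ - 1) e else 0) := by
    split_ifs with h'
    · exact ih (by omega) (by omega) (by omega) (by omega) hc (by omega)
    · simp
  have p3 : ((if 1 ≤ e then skewCount c i r₁ r₂ (e - 1) c' else 0 : ℕ) : ℚ) =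
      (s - 1).choose c' * (if 1 ≤ e then nearHookCount r₁ r₂ (e - 1) else 0) := by
    split_ifs with h'
    · exact ih (by omega) (by omega) (by omega) (by omega) hc (by omega)
    · simp
  have hpascal : ((s + 1 - 1).choose c' : ℚ) =
      (if 1 ≤ c' then ((s - 1).choose (c' - 1) : ℚ) else 0) + (s - 1).choose c' := by
    obtain ⟨s, rfl⟩ : ∃ n, s = n + 1 := ⟨s - 1, by omega⟩
    rcases c' with _ | c'
    · simp
    · simp [Nat.choose_succ_succ]
  push_cast only [Nat.cast_add]
  rw [p1, p2, p3, hlast, hpascal, add_mul, ← mul_add, ← mul_add,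
    ← nearHookCount_rec h₁ h₂₁ he (by omega)]
  ring

/-- Pascal's rule splits the sum in two; as `g (j + 1) = f j`, the part with lower index `c - (j +
1)` cancels the `g`-part of the other, except for its term at `j = 0`. -/
theorem sum_alternating_mul_choose_succ (f g u : ℕ → ℚ) (hf : ∀ j, f j = g j + u j)
    (hg : ∀ j, g (j + 1) = f j) (N c : ℕ) :
    ∑ j ∈ Finset.range (c + 1), (-1) ^ j * f j * (N + 1).choose (c - j) =
      g 0 * N.choose c + ∑ j ∈ Finset.range (c + 1), (-1) ^ j * u j * N.choose (c - j) := by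
  have h1 : ∑ j ∈ Finset.range (c + 1), (-1) ^ j * f j * ((N + 1).choose (c - j) : ℚ) =
      ∑ j ∈ Finset.range c, (-1) ^ j * f j * (N.choose (c - (j + 1)) : ℚ) +
      ∑ j ∈ Finset.range (c + 1), (-1) ^ j * f j * (N.choose (c - j) : ℚ) := by
    rw [Finset.sum_range_succ, Finset.sum_range_succ, ← add_assoc, ← Finset.sum_add_distrib]
    congr 1
    · refine Finset.sum_congr rfl fun j hj => ?_
      rw [Finset.mem_range] at hj
      rw [show c - j = (c - (j + 1)) + 1 by omega, Nat.choose_succ_succ]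
      push_cast
      ring
    · simp
  have h2 : ∑ j ∈ Finset.range (c + 1), (-1) ^ j * g j * (N.choose (c - j) : ℚ) =
      g 0 * N.choose c -
        ∑ j ∈ Finset.range c, (-1) ^ j * f j * (N.choose (c - (j + 1)) : ℚ) := by
    rw [Finset.sum_range_succ', add_comm, sub_eq_add_neg, ← Finset.sum_neg_distrib]
    congr 1
    · simp
    · refine Finset.sum_congr rfl fun j _ => ?_
      rw [hg]
      ring
  have h3 : ∑ j ∈ Finset.range (c + 1), (-1) ^ j * f j * (N.choose (c - j) : ℚ) =
      ∑ j ∈ Finset.range (c + 1), (-1) ^ j * g j * (N.choose (c - j) : ℚ) +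
      ∑ j ∈ Finset.range (c + 1), (-1) ^ j * u j * (N.choose (c - j) : ℚ) := by
    rw [← Finset.sum_add_distrib]
    refine Finset.sum_congr rfl fun j _ => ?_
    rw [hf]
    ring
  rw [h1, h3, h2]
  ring

/-- Inclusion-exclusion: detach the column of `c` boxes from the end of row `c`. In an unwanted
shuffle the foot of the column exceeds the last box of the row, so it can be appended to the row;
this is a wanted filling with a longer row and a shorter column. Iterating gives the alternating
sum. The formal proof checks that both sides obey the corner recursion. -/
theorem skewCount_eq_sum {c i r₂ e : ℕ} (hi : 1 ≤ i) (h₂₁ : r₂ ≤ i + 1) (he : r₂ = 0 → e = 0) :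
    (skewCount c i (i + 1) r₂ e c : ℚ) =
      ∑ j ∈ Finset.range (c + 1),
        (-1) ^ j * nearHookCount (i + 1 + j) r₂ e * (i + r₂ + e + c).choose (c - j) := by
  induction hs : r₂ + e using Nat.strong_induction_on generalizing r₂ e with
  | _ s ih
  obtain ⟨N, hN⟩ : ∃ N, i + r₂ + e + c = N + 1 := ⟨i + r₂ + e + c - 1, by omega⟩
  rw [skewCount_rec hi (by omega) le_rfl h₂₁ he le_rfl (fun _ => rfl) (by omega), hN,
    sum_alternating_mul_choose_succ (fun j => nearHookCount (i + 1 + j) r₂ e)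
      (fun j => if r₂ < i + 1 + j ∧ 2 ≤ i + 1 + j then nearHookCount (i + 1 + j - 1) r₂ e else 0)
      (fun j => (if 1 ≤ r₂ ∧ (2 ≤ r₂ ∨ e = 0) then nearHookCount (i + 1 + j) (r₂ - 1) e else 0) +
        (if 1 ≤ e then nearHookCount (i + 1 + j) r₂ (e - 1) else 0))]
  · rw [if_neg (by omega : ¬ (1 ≤ c ∧ i + 1 ≤ i)), add_zero, add_assoc, Nat.cast_add]
    congr 1
    · simp only [add_zero]
      split_ifs with h'
      · rw [skewCount_eq_of_le hi (by omega) (by omega) (by omega) he le_rfl, mul_comm]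
        congr 3
        omega
      · simp
    · simp only [mul_add, add_mul, Finset.sum_add_distrib]
      rw [Nat.cast_add]
      congr 1
      · split_ifs with h'
        · rw [ih _ (by omega) (by omega) (by omega) rfl]
          rw [show i + (r₂ - 1) + e + c = N by omega]
        · simp
      · split_ifs with h'
        · rw [ih _ (by omega) (by omega) (by omega) rfl]
          rw [show i + r₂ + (e - 1) + c = N by omega]
        · simp
  · intro j
    rw [← add_assoc]
    exact nearHookCount_rec (by omega) (by omega) he (by omega)
  · intro j
    rw [if_pos (by omega)]
    rfl

/-- All terms of the recursion are nonnegative. Boxes are removed from row `c + 1` and below until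
only row `c` and column `i` remain; the end of row `c` is then removed and the product formula
applies. -/
theorem skewCount_pos {c i r₂ e : ℕ} (hi : 1 ≤ i) (h₂₁ : r₂ ≤ i + 1) (he : r₂ = 0 → e = 0) :
    0 < skewCount c i (i + 1) r₂ e c := by
  induction hs : r₂ + e using Nat.strong_induction_on generalizing r₂ e with
  | _ s ih
  rw [skewCount_rec hi (by omega) le_rfl h₂₁ he le_rfl (fun _ => rfl) (by omega)]
  by_cases h₁ : 1 ≤ r₂ ∧ (2 ≤ r₂ ∨ e = 0)
  · rw [if_pos h₁]
    have := ih _ (by omega) (r₂ := r₂ - 1) (e := e) (by omega) (by omega) rfl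
    omega
  by_cases h₂ : 1 ≤ e
  · rw [if_pos h₂]
    have := ih _ (by omega) (r₂ := r₂) (e := e - 1) (by omega) (by omega) rfl
    omega
  · rw [if_pos (by omega : r₂ < i + 1 ∧ 2 ≤ i + 1)]
    have h : (0 : ℚ) < skewCount c i (i + 1 - 1) r₂ e c := by
      rw [skewCount_eq_of_le hi (by omega) (by omega) (by omega) he le_rfl]
      have h1 : (0 : ℚ) < (i + 1 - 1 + r₂ + e + c - 1).choose c := by
        exact_mod_cast Nat.choose_pos (by omega)
      have := nearHookCount_pos (r₁ := i + 1 - 1) (r₂ := r₂) (e := e) (by omega)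
      positivity
    have : 0 < skewCount c i (i + 1 - 1) r₂ e c := by exact_mod_cast h
    omega

/-! ### Identification with restricted skew tableaux -/

theorem skytBoxes_eq_skewBoxes {d i c : ℕ} (hi : 1 ≤ i) :
    skytBoxes (d + 2) i (c + 2) = skewBoxes c i (i + 1) (i + 1) d c := by
  ext ⟨x, y⟩
  rw [mem_skewBoxes]
  simp only [skytBoxes, Finset.mem_union, Finset.mem_product, Finset.mem_singleton,
    Finset.mem_range, Finset.mem_Ico]
  omega

theorem card_skewBoxes {d i c : ℕ} (hi : 1 ≤ i) :
    (skewBoxes c i (i + 1) (i + 1) d c).card = d + 2 + 2 * i + (c + 2) - 2 := by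
  rw [skewBoxes, Finset.card_union_of_disjoint, Finset.card_union_of_disjoint,
    Finset.card_union_of_disjoint]
  · simp
    omega
  all_goals
    simp only [Finset.disjoint_left, Finset.mem_union, Finset.mem_product, Finset.mem_singleton,
      Finset.mem_range, Finset.mem_Ico, Prod.forall]
    intro x y h h'
    omega

/-- Extending a filling by zero gives the bijection; having entry 1 at `(c, 0)` means that `(c, 0)`
is the least box. -/
theorem skytBar_eq_skewCount {d i c : ℕ} (hi : 1 ≤ i) :
    skytBar (d + 2) i (c + 2) = skewCount c i (i + 1) (i + 1) d c := by
  classical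
  rw [skytBar, if_neg (by omega), skewCount, ← skytBoxes_eq_skewBoxes hi]
  have hcard : (skytBoxes (d + 2) i (c + 2)).card = d + 2 + 2 * i + (c + 2) - 2 := by
    rw [skytBoxes_eq_skewBoxes hi, card_skewBoxes hi]
  refine ncard_congr
    (fun T _ x => if h : x ∈ skytBoxes (d + 2) i (c + 2) then (T ⟨x, h⟩ : ℕ) else 0) ?_ ?_ ?_
  · rintro T ⟨⟨hT, hrow, hcol⟩, h1⟩
    refine ⟨⟨?_, ?_, ?_⟩, ?_, ?_⟩
    · intro x hx
      have hx' : x ∈ skytBoxes (d + 2) i (c + 2) := hx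
      simp only [hx', dif_pos, hcard]
      exact Finset.mem_Icc.1 (T ⟨x, hx'⟩).2
    · intro x hx y hy hxy
      have hx' : x ∈ skytBoxes (d + 2) i (c + 2) := hx
      have hy' : y ∈ skytBoxes (d + 2) i (c + 2) := hy
      simp only [hx', hy', dif_pos] at hxy
      simpa using hT.1 (Subtype.ext hxy)
    · intro n hn
      rw [hcard] at hn
      obtain ⟨⟨x, hx⟩, hxn⟩ := hT.2 ⟨n, Finset.mem_Icc.2 hn⟩
      exact ⟨x, hx, by simp only [hx, dif_pos, hxn]⟩
    · intro x hx
      simp only [hx, dif_neg, not_false_eq_true]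
    · intro x hx y hy hxy
      simp only [hx, hy, dif_pos]
      rcases hxy with hxy | hxy | ⟨hx0, hyx⟩
      · exact hrow ⟨x, hx⟩ ⟨y, hy⟩ hxy.1 hxy.2
      · exact hcol ⟨x, hx⟩ ⟨y, hy⟩ hxy.1 hxy.2
      · have e1 := h1 ⟨x, hx⟩ hx0
        have e2 := (Finset.mem_Icc.1 (T ⟨y, hy⟩).2).1
        have e3 : (T ⟨y, hy⟩ : ℕ) ≠ T ⟨x, hx⟩ := fun h =>
          hyx (Subtype.mk.inj (hT.1 (Subtype.ext h)))
        omega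
  · intro T T' _ _ h
    funext ⟨x, hx⟩
    have := congrFun h x
    simp only [hx, dif_pos] at this
    exact Subtype.ext this
  · rintro T ⟨hb, h0, hR⟩
    rw [hcard] at hb
    have hlt : ∀ x y : skytBoxes (d + 2) i (c + 2), skewRel c x.1 y.1 → T x.1 < T y.1 :=
      fun x y => hR x.1 x.2 y.1 y.2
    refine ⟨fun x => ⟨T x.1, Finset.mem_Icc.2 (hb.mapsTo x.2)⟩, ⟨⟨⟨?_, ?_⟩, ?_, ?_⟩, ?_⟩, ?_⟩
    · intro x y hxy
      exact Subtype.ext (hb.injOn x.2 y.2 (Subtype.mk.inj hxy))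
    · rintro ⟨n, hn⟩
      obtain ⟨x, hx, hxn⟩ := hb.surjOn (Finset.mem_Icc.1 hn)
      exact ⟨⟨x, hx⟩, Subtype.ext hxn⟩
    · exact fun x y h h' => hlt x y (Or.inl ⟨h, h'⟩)
    · exact fun x y h h' => hlt x y (Or.inr (Or.inl ⟨h, h'⟩))
    · intro x hx
      obtain ⟨y, hy, hy1⟩ := hb.surjOn (show 1 ∈ Icc 1 (d + 2 + 2 * i + (c + 2) - 2) from
        ⟨le_rfl, by omega⟩)
      by_cases hyx : y = x.1
      · exact (congrArg T hyx).symm.trans hy1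
      · have := hR x.1 x.2 y hy (Or.inr (Or.inr ⟨hx, hyx⟩))
        have := (hb.mapsTo x.2).1
        omega
    · funext x
      split_ifs with h
      · rfl
      · exact (h0 x h).symm

/-! ### Binomial transforms -/

section BinomialTransform

variable {R : Type*} [CommRing R]

/-- The binomial transform of a sequence, with the binomial coefficients shifted by `d`. -/
def binomialShift (d : ℕ) (s : R) (f : ℕ → R) (k : ℕ) : R :=
  ∑ j ∈ Finset.range (k + 1), (k + d).choose j * s ^ j * f (k - j)

/-- Formally, the transform multiplies the series with terms `f k * z ^ (k + d) / (k + d)!` by the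
exponential of `s * z`, so parameters add. The proof regroups by `j + l` and uses the binomial
theorem. -/
theorem binomialShift_binomialShift (d : ℕ) (s t : R) (f : ℕ → R) (k : ℕ) :
    binomialShift d s (binomialShift d t f) k = binomialShift d (s + t) f k := by
  have h1 : binomialShift d s (binomialShift d t f) k =
      ∑ j ∈ Finset.range (k + 1), ∑ l ∈ Finset.range (k + 1 - j),
        (k + d).choose j * s ^ j * ((k - j + d).choose l * t ^ l * f (k - (j + l))) := by
    refine Finset.sum_congr rfl fun j hj => ?_
    rw [Finset.mem_range] at hj
    rw [binomialShift, Finset.mul_sum, show k + 1 - j = k - j + 1 by omega]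
    refine Finset.sum_congr rfl fun l _ => ?_
    rw [Nat.sub_sub]
  rw [h1, ← Finset.sum_range_diag_flip (k + 1) fun j l =>
    (k + d).choose j * s ^ j * ((k - j + d).choose l * t ^ l * f (k - (j + l))), binomialShift]
  refine Finset.sum_congr rfl fun p hp => ?_
  rw [add_pow, Finset.mul_sum, Finset.sum_mul]
  refine Finset.sum_congr rfl fun j hj => ?_
  rw [Finset.mem_range] at hp hj
  have hc : ((k + d).choose p * p.choose j : R) = (k + d).choose j * (k - j + d).choose (p - j) := by
    rw [← Nat.cast_mul, ← Nat.cast_mul, Nat.choose_mul (by omega),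
      show k - j + d = k + d - j by omega]
  rw [show j + (p - j) = p by omega]
  linear_combination (-(s ^ j * t ^ (p - j) * f (k - p))) * hc

theorem binomialShift_zero (d : ℕ) (f : ℕ → R) (k : ℕ) : binomialShift d 0 f k = f k := by
  rw [binomialShift, Finset.sum_range_succ', Finset.sum_eq_zero]
  · simp
  · intro j _
    simp

theorem binomialShift_sub (d : ℕ) (s : R) (f g : ℕ → R) (k : ℕ) :
    binomialShift d s (fun n => f n - g n) k = binomialShift d s f k - binomialShift d s g k := by
  simp only [binomialShift, mul_sub, Finset.sum_sub_distrib]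

end BinomialTransform

/-! ### Alternating binomial sums and the symmetric identity -/

/-- This is the Beta integral of `x ^ d * (1 - x) ^ m` over the unit interval, proved here by
Pascal's rule. -/
theorem sum_neg_one_pow_mul_choose_div (m d : ℕ) :
    ∑ i ∈ Finset.range (m + 1), (-1) ^ i * (m.choose i : ℚ) / (i + d + 1) =
      m.factorial * d.factorial / (m + d + 1).factorial := by
  induction m generalizing d with
  | zero =>
    simp [Nat.factorial_succ]
    field_simp
  | succ m ih =>
    have h : ∑ i ∈ Finset.range (m + 2), (-1) ^ i * ((m + 1).choose i : ℚ) / (i + d + 1) =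
        ∑ i ∈ Finset.range (m + 1), (-1) ^ i * (m.choose i : ℚ) / (i + d + 1) -
        ∑ i ∈ Finset.range (m + 1), (-1) ^ i * (m.choose i : ℚ) / (i + (d + 1 : ℕ) + 1) := by
      have e1 : ∑ i ∈ Finset.range (m + 1), (-1) ^ i * (m.choose i : ℚ) / (i + d + 1) =
          ∑ i ∈ Finset.range (m + 2), (-1) ^ i * (m.choose i : ℚ) / (i + d + 1) := by
        rw [Finset.sum_range_succ _ (m + 1), Nat.choose_succ_self]
        simp
      rw [e1, Finset.sum_range_succ', Finset.sum_range_succ' _ (m + 1), add_sub_right_comm,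
        ← Finset.sum_sub_distrib]
      congr 1
      · refine Finset.sum_congr rfl fun i _ => ?_
        rw [Nat.choose_succ_succ]
        push_cast
        have : (i + 1 + d + 1 : ℚ) = i + (d + 1) + 1 := by ring
        rw [this]
        ring
      · simp
    rw [h, ih, ih, show m + (d + 1) + 1 = m + d + 1 + 1 by ring,
      show m + 1 + d + 1 = m + d + 1 + 1 by ring, Nat.factorial_succ (m + d + 1),
      Nat.factorial_succ m, Nat.factorial_succ d]
    push_cast
    field_simp
    ring

theorem sum_neg_one_pow_mul_choose_mul_self (n : ℕ) :
    ∑ i ∈ Finset.range (n + 1), (-1) ^ i * (n.choose i : ℚ) * i = if n = 1 then -1 else 0 := by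
  rcases n with _ | n
  · simp
  have h : ∀ i ∈ Finset.range (n + 1), (-1) ^ (i + 1) * ((n + 1).choose (i + 1) : ℚ) * (i + 1 : ℕ) =
      -(n + 1) * (((-1) ^ i * (n.choose i : ℤ) : ℤ) : ℚ) := by
    intro i _
    have := Nat.add_one_mul_choose_eq n i
    have h2 : ((n + 1) * n.choose i : ℚ) = (n + 1).choose (i + 1) * (i + 1) := by
      exact_mod_cast this
    push_cast
    rw [pow_succ]
    linear_combination (-1) ^ i * h2
  rw [Finset.sum_range_succ', Finset.sum_congr rfl h, ← Finset.mul_sum, ← Int.cast_sum,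
    Int.alternating_sum_range_choose]
  by_cases hn : n = 0 <;> simp [hn]

/-- The weight in the double sums for the numbers of restricted skew tableaux. -/
def skytWeight (d x y : ℕ) : ℚ :=
  (-1) ^ (x + y + 1) * (x / (y + d + 1) - y / (x + d + 1))

theorem skytWeight_swap (d x y : ℕ) : skytWeight d x y = -skytWeight d y x := by
  rw [skytWeight, skytWeight, add_comm y x]
  ring

/-- The coefficient of `t ^ i` in the relaxation polynomial for rank `n + i` and hyperplanes of
cardinality `n + i + d`. -/
def skytCoeff (d n i : ℕ) : ℚ :=
  (n + i + d).factorial / (d.factorial * n.factorial * i.factorial) *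
    ∑ x ∈ Finset.range (n + 1), if i < x then skytWeight d x i * n.choose x else 0

theorem skytCoeff_eq_zero {d n i : ℕ} (h : n ≤ i) : skytCoeff d n i = 0 := by
  rw [skytCoeff, Finset.sum_eq_zero, mul_zero]
  intro x hx
  rw [Finset.mem_range] at hx
  rw [if_neg (by omega)]

/-- This makes the exceptional value 1 in rank one an instance of the general coefficient formula.
-/
theorem skytCoeff_zero_right (d n : ℕ) : skytCoeff d n 0 = if n = 1 then 1 else 0 := by
  have h : ∀ x ∈ Finset.range (n + 1),
      (if 0 < x then skytWeight d x 0 * (n.choose x : ℚ) else 0) =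
        -1 / (d + 1) * ((-1) ^ x * (n.choose x : ℚ) * x) := by
    intro x _
    rcases x with _ | x
    · simp
    · rw [if_pos (by omega), skytWeight]
      push_cast
      field_simp
      ring
  rw [skytCoeff, Finset.sum_congr rfl h, ← Finset.mul_sum, sum_neg_one_pow_mul_choose_mul_self]
  split_ifs with h
  · subst h
    rw [show 1 + 0 + d = d + 1 by ring, Nat.factorial_succ]
    simp
    field_simp
  · simp

/-- Substitute `x = i + 1 + j` in the alternating sum. The weight comes from the hook lengths: `x /
(i + d + 1) - i / (x + d + 1)` has numerator `(x - i) * (x + i + d + 1)`, whose second factor is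
absorbed by the factorials. -/
theorem skytBar_eq_skytCoeff {d n i : ℕ} (hi : 1 ≤ i) (h : i < n) :
    (skytBar (d + 2) i (n - i + 1) : ℚ) = skytCoeff d n i := by
  obtain ⟨c, rfl⟩ : ∃ c, n = i + 1 + c := ⟨n - (i + 1), by omega⟩
  rw [show i + 1 + c - i + 1 = c + 2 by omega, skytBar_eq_skewCount hi,
    skewCount_eq_sum hi le_rfl (by omega), skytCoeff, ← Finset.sum_filter, Finset.mul_sum]
  symm
  refine Finset.sum_bij' (fun x _ => x - (i + 1)) (fun j _ => i + 1 + j) ?_ ?_ ?_ ?_ ?_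
  · intro x hx
    simp only [Finset.mem_filter, Finset.mem_range] at hx ⊢
    omega
  · intro x hx
    simp only [Finset.mem_filter, Finset.mem_range] at hx ⊢
    omega
  · intro x hx
    simp only [Finset.mem_filter, Finset.mem_range] at hx ⊢
    omega
  · intro x hx
    omega
  · intro x hx
    simp only [Finset.mem_filter, Finset.mem_range] at hx
    obtain ⟨j, rfl⟩ : ∃ j, x = i + 1 + j := ⟨x - (i + 1), by omega⟩
    rw [Nat.add_sub_cancel_left, nearHookCount, if_neg (by omega), Nat.add_sub_cancel, skytWeight,
      Nat.cast_choose ℚ (show i + 1 + j ≤ i + 1 + c by omega),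
      Nat.cast_choose ℚ (show c - j ≤ i + (i + 1) + d + c by omega),
      show i + 1 + c - (i + 1 + j) = c - j by omega,
      show i + (i + 1) + d + c - (c - j) = i + j + i + 1 + d by omega,
      show i + 1 + j + (i + 1) + d = (i + j + i + 1 + d) + 1 by ring,
      show i + (i + 1) + d + c = i + 1 + c + i + d by ring, Nat.factorial_succ (i + j + i + 1 + d),
      show i + 1 + j + i + 1 = 2 * (i + 1) + j by ring, pow_add, pow_mul]
    push_cast
    field_simp
    ring

theorem sum_choose_mul_skytCoeff (d m n : ℕ) :
    ∑ i ∈ Finset.range (m + 1), ((d + m + n).choose (m - i) : ℚ) * skytCoeff d n i =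
      (d + m + n).factorial / (d.factorial * n.factorial * m.factorial) *
        ∑ i ∈ Finset.range (m + 1), ∑ x ∈ Finset.range (n + 1),
          if i < x then skytWeight d x i * n.choose x * m.choose i else 0 := by
  rw [Finset.mul_sum]
  refine Finset.sum_congr rfl fun i hi => ?_
  rw [Finset.mem_range] at hi
  have h : ∀ x ∈ Finset.range (n + 1),
      (if i < x then skytWeight d x i * n.choose x * m.choose i else 0 : ℚ) =
      (if i < x then skytWeight d x i * n.choose x else 0) * m.choose i := by
    intro x _
    split_ifs <;> simp
  rw [Finset.sum_congr rfl h, ← Finset.sum_mul, skytCoeff,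
    Nat.cast_choose ℚ (show m - i ≤ d + m + n by omega), Nat.cast_choose ℚ (show i ≤ m by omega),
    show d + m + n - (m - i) = n + i + d by omega]
  field_simp

/-- Both sums carry the same multinomial prefactor. Since the weight is antisymmetric, subtracting
the sum with `m` and `n` exchanged turns the range `i < x` into the whole rectangle. There each half
of the weight is a product of a function of `x` and a function of `i`. -/
theorem sum_choose_mul_skytCoeff_sub (d m n : ℕ) :
    ∑ i ∈ Finset.range (m + 1), ((d + m + n).choose (m - i) : ℚ) * skytCoeff d n i -
      ∑ i ∈ Finset.range (n + 1), ((d + m + n).choose (n - i) : ℚ) * skytCoeff d m i =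
    (if n = 1 then 1 else 0) - (if m = 1 then 1 else 0) := by
  have h2 := sum_choose_mul_skytCoeff d n m
  rw [show d + n + m = d + m + n by ring] at h2
  rw [sum_choose_mul_skytCoeff, h2, Finset.sum_comm (s := Finset.range (n + 1)),
    show (d.factorial * m.factorial * n.factorial : ℚ) =
      d.factorial * n.factorial * m.factorial by ring, ← mul_sub, ← Finset.sum_sub_distrib]
  have h3 : ∀ i ∈ Finset.range (m + 1),
      (∑ x ∈ Finset.range (n + 1),
        if i < x then skytWeight d x i * n.choose x * m.choose i else (0 : ℚ)) -
      (∑ x ∈ Finset.range (n + 1),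
        if x < i then skytWeight d i x * m.choose i * n.choose x else (0 : ℚ)) =
      ((-1) ^ i * (m.choose i : ℚ) * i) *
        (∑ x ∈ Finset.range (n + 1), (-1) ^ x * (n.choose x : ℚ) / (x + d + 1)) -
      ((-1) ^ i * (m.choose i : ℚ) / (i + d + 1)) *
        (∑ x ∈ Finset.range (n + 1), (-1) ^ x * (n.choose x : ℚ) * x) := by
    intro i _
    rw [← Finset.sum_sub_distrib, Finset.mul_sum, Finset.mul_sum, ← Finset.sum_sub_distrib]
    refine Finset.sum_congr rfl fun x _ => ?_
    have e : (if i < x then skytWeight d x i * n.choose x * m.choose i else (0 : ℚ)) -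
        (if x < i then skytWeight d i x * m.choose i * n.choose x else (0 : ℚ)) =
        skytWeight d x i * n.choose x * m.choose i := by
      rcases lt_trichotomy i x with h | h | h
      · rw [if_pos h, if_neg (by omega), sub_zero]
      · subst h
        rw [if_neg (by omega), if_neg (by omega), skytWeight, sub_self]
        ring
      · rw [if_neg (by omega), if_pos h, skytWeight_swap d x i]
        ring
    rw [e, skytWeight]
    ring
  rw [Finset.sum_congr rfl h3, Finset.sum_sub_distrib, ← Finset.sum_mul, ← Finset.sum_mul,
    sum_neg_one_pow_mul_choose_mul_self, sum_neg_one_pow_mul_choose_mul_self,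
    sum_neg_one_pow_mul_choose_div, sum_neg_one_pow_mul_choose_div]
  have key : ∀ a b : ℕ, b = 1 → ((a + d + 1).factorial : ℚ) /
      (d.factorial * b.factorial * a.factorial) * (a.factorial * d.factorial /
        (a + d + 1).factorial) = 1 := by
    rintro a b rfl
    simp
    field_simp
  by_cases hn : n = 1 <;> by_cases hm : m = 1
  · subst hn hm
    simp
  · subst hn
    have := key m 1 rfl
    rw [show d + m + 1 = m + d + 1 by ring]
    simp only [if_true, hm, if_false]
    linear_combination this
  · subst hm
    have := key n 1 rfl
    rw [show d + 1 + n = n + d + 1 by ring]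
    simp only [if_true, hn, if_false]
    linear_combination -this
  · simp [hn, hm]

/-! ### The relaxation polynomials and their functional equation -/

/-- The relaxation polynomial for rank `k` and stressed hyperplanes of cardinality `k + d`. -/
noncomputable def klRelaxPoly (d k : ℕ) : ℤ[X] :=
  if k = 1 then 1 else
    ∑ i ∈ Finset.range ((k - 1) / 2 + 1), C (skytBar (d + 2) i (k + 1 - 2 * i) : ℤ) * X ^ i

theorem skytBar_zero (a b : ℕ) : skytBar a 0 b = 0 := by simp [skytBar]

theorem klRelaxPoly_zero (d : ℕ) : klRelaxPoly d 0 = 0 := by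
  simp [klRelaxPoly, skytBar_zero]

theorem coeff_klRelaxPoly (d k i : ℕ) :
    ((klRelaxPoly d k).coeff i : ℚ) = if i ≤ k then skytCoeff d (k - i) i else 0 := by
  rw [klRelaxPoly]
  by_cases hk : k = 1
  · subst hk
    rcases i with _ | i
    · simp [skytCoeff_zero_right]
    · rw [if_pos rfl, coeff_one, if_neg (by omega), skytCoeff_eq_zero (by omega)]
      simp
  rw [if_neg hk, finsetSum_coeff]
  simp only [coeff_C_mul_X_pow]
  rw [Finset.sum_ite_eq]
  split_ifs with h1 h2 h2
  · rcases Nat.eq_zero_or_pos i with rfl | hi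
    · rw [skytBar_zero, skytCoeff_zero_right, if_neg (by omega)]
      simp
    · rw [Finset.mem_range] at h1
      rw [← skytBar_eq_skytCoeff hi (by omega), show k - i - i + 1 = k + 1 - 2 * i by omega]
      simp
  · rw [Finset.mem_range] at h1
    rcases Nat.eq_zero_or_pos i with rfl | hi
    · omega
    · omega
  · rw [Finset.mem_range] at h1
    rw [skytCoeff_eq_zero (by omega)]
    simp
  · simp

theorem coeff_klRelaxPoly_eq_zero {d k i : ℕ} (h : k ≤ 2 * i) : (klRelaxPoly d k).coeff i = 0 := by
  have := coeff_klRelaxPoly d k i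
  split_ifs at this with h1
  · rw [skytCoeff_eq_zero (by omega)] at this
    exact_mod_cast this
  · exact_mod_cast this

/-- The defect of palindromicity in the recursion for the relaxation polynomials. -/
noncomputable def klRelaxDefect (k : ℕ) : ℤ[X] := if k = 0 then 0 else X ^ (k - 1) - X

/-- The right side is the reflection in degree `k` of the transform on the left. At `t ^ m` with `k
= m + n`, the two coefficients are the sums of `sum_choose_mul_skytCoeff_sub`, with `m` and `n`
exchanged. -/
theorem binomialShift_X_klRelaxPoly (d k : ℕ) :
    binomialShift d X (klRelaxPoly d) k - klRelaxDefect k =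
      binomialShift d 1 (fun r => reflect r (klRelaxPoly d r)) k := by
  rcases Nat.eq_zero_or_pos k with rfl | hk
  · simp [binomialShift, klRelaxPoly_zero, klRelaxDefect]
  ext m
  apply Int.cast_injective (α := ℚ)
  simp only [binomialShift, klRelaxDefect, if_neg hk.ne', coeff_sub, finsetSum_coeff, coeff_X_pow,
    coeff_X, one_pow, mul_one, mul_assoc, ← C_eq_natCast, coeff_C_mul, coeff_X_pow_mul',
    coeff_reflect]
  push_cast
  rcases Nat.lt_or_ge k m with hm | hm
  · rw [if_neg (by omega), if_neg (by omega), Finset.sum_eq_zero, Finset.sum_eq_zero]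
    · simp
    · intro j hj
      rw [revAt_eq_self_of_lt (by omega), coeff_klRelaxPoly_eq_zero (by omega)]
      simp
    · intro j hj
      rw [Finset.mem_range] at hj
      split_ifs with h
      · rw [coeff_klRelaxPoly, if_neg (by omega), mul_zero]
      · simp
  obtain ⟨n, rfl⟩ : ∃ n, k = m + n := ⟨k - m, by omega⟩
  have key := sum_choose_mul_skytCoeff_sub d m n
  have e1 : ∑ j ∈ Finset.range (m + n + 1), ((m + n + d).choose j : ℚ) *
      (if j ≤ m then ((klRelaxPoly d (m + n - j)).coeff (m - j) : ℚ) else 0) =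
      ∑ i ∈ Finset.range (m + 1), ((d + m + n).choose (m - i) : ℚ) * skytCoeff d n i := by
    rw [← Finset.sum_range_reflect _ (m + 1)]
    symm
    refine Finset.sum_subset_zero_on_sdiff (Finset.range_subset_range.2 (by omega)) ?_ ?_
    · intro j hj
      rw [Finset.mem_sdiff, Finset.mem_range, Finset.mem_range] at hj
      rw [if_neg (by omega)]
      simp
    · intro j hj
      rw [Finset.mem_range] at hj
      rw [if_pos (by omega), coeff_klRelaxPoly, if_pos (by omega),
        show m - (m + 1 - 1 - j) = j by omega, show m + 1 - 1 - j = m - j by omega,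
        show m + n - j - (m - j) = n by omega, show d + m + n = m + n + d by ring]
  have e2 : ∑ j ∈ Finset.range (m + n + 1), ((m + n + d).choose j : ℚ) *
      ((klRelaxPoly d (m + n - j)).coeff ((revAt (m + n - j)) m) : ℚ) =
      ∑ i ∈ Finset.range (n + 1), ((d + m + n).choose (n - i) : ℚ) * skytCoeff d m i := by
    rw [← Finset.sum_range_reflect _ (n + 1)]
    symm
    refine Finset.sum_subset_zero_on_sdiff (Finset.range_subset_range.2 (by omega)) ?_ ?_
    · intro j hj
      rw [Finset.mem_sdiff, Finset.mem_range, Finset.mem_range] at hj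
      -- For `j > n` the exponent `m` exceeds `k - j`; `revAt` then fixes it, and the coefficient is
      -- zero for degree reasons.
      rw [revAt_eq_self_of_lt (by omega), coeff_klRelaxPoly_eq_zero (by omega)]
      simp
    · intro j hj
      rw [Finset.mem_range] at hj
      rw [revAt_le (by omega), coeff_klRelaxPoly, if_pos (by omega),
        show n - (n + 1 - 1 - j) = j by omega, show n + 1 - 1 - j = m + n - j - m by omega,
        show m + n - j - (m + n - j - m) = m by omega, show d + m + n = m + n + d by ring]
  rw [e1, e2]
  have c1 : m = m + n - 1 ↔ n = 1 := by omega
  have c2 : 1 = m ↔ m = 1 := eq_comm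
  simp only [c1, c2]
  linear_combination key

/-- Applying the transform with parameter -1 to the previous identity inverts its right side. -/
theorem binomialShift_klRelaxPoly (d k : ℕ) :
    binomialShift d (X - 1) (klRelaxPoly d) k - binomialShift d (-1) klRelaxDefect k =
      reflect k (klRelaxPoly d k) := by
  have h := binomialShift_binomialShift d (-1 : ℤ[X]) 1 (fun r => reflect r (klRelaxPoly d r)) k
  rw [neg_add_cancel, binomialShift_zero] at h
  rw [← h, ← funext (binomialShift_X_klRelaxPoly d), binomialShift_sub,
    binomialShift_binomialShift, neg_add_eq_sub]

theorem coeff_binomialShift_klRelaxPoly {d k m : ℕ} (hm : 2 * m < k) :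
    (binomialShift d (X - 1) (klRelaxPoly d) k).coeff m =
      (binomialShift d (-1) klRelaxDefect k).coeff m := by
  rw [← sub_eq_zero, ← coeff_sub, binomialShift_klRelaxPoly, coeff_reflect, revAt_le (by omega),
    coeff_klRelaxPoly_eq_zero (by omega)]

theorem coeff_klRelaxPoly_nonneg (d k i : ℕ) : 0 ≤ (klRelaxPoly d k).coeff i := by
  rw [klRelaxPoly]
  split_ifs with h
  · rw [coeff_one]
    split_ifs <;> simp
  · rw [finsetSum_coeff]
    refine Finset.sum_nonneg fun j _ => ?_
    rw [coeff_C_mul_X_pow]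
    split_ifs <;> simp

theorem degree_klRelaxPoly {d k : ℕ} (hk : 1 ≤ k) (hk2 : k ≠ 2) :
    (klRelaxPoly d k).degree = ((k - 1) / 2 : ℕ) := by
  by_cases h1 : k = 1
  · subst h1
    simp [klRelaxPoly]
  refine le_antisymm ?_ ?_
  · rw [degree_le_iff_coeff_zero]
    intro m hm
    have hm' : (k - 1) / 2 < m := by exact_mod_cast hm
    exact coeff_klRelaxPoly_eq_zero (by omega)
  · refine le_degree_of_ne_zero ?_
    rw [klRelaxPoly, if_neg h1, finsetSum_coeff]
    simp only [coeff_C_mul_X_pow]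
    rw [Finset.sum_ite_eq, if_pos (by simp),
      show k + 1 - 2 * ((k - 1) / 2) = (k - 1 - 2 * ((k - 1) / 2)) + 2 by omega,
      skytBar_eq_skewCount (by omega)]
    exact_mod_cast (skewCount_pos (by omega) le_rfl (by omega)).ne'

/-! ### Stressed hyperplanes and their relaxations -/

namespace Matroid

variable {α : Type*} {M : Matroid α} {H A F : Set α}

theorem Indep.contract_eRk_add_encard (hF : M.Indep F) (hA : A ⊆ M.E \ F) :
    (M ／ F).eRk A + F.encard = M.eRk (A ∪ F) := by
  obtain ⟨J, hJ⟩ := (M ／ F).exists_isBasis A hA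
  rw [← hJ.encard_eq_eRk, ← (hF.union_isBasis_union_of_contract_isBasis hJ).encard_eq_eRk,
    encard_union_eq]
  exact disjoint_of_subset_left hJ.subset (subset_sdiff.1 hA).2

theorem Indep.contract_eRank_add_encard (hF : M.Indep F) :
    (M ／ F).eRank + F.encard = M.eRank := by
  rw [← eRk_ground, contract_ground, hF.contract_eRk_add_encard Subset.rfl,
    sdiff_union_of_subset hF.subset_ground, eRk_ground]

theorem IsHyperplane.exists_notMem (hH : M.IsHyperplane H) (hr : M.eRank ≠ ⊤) :
    ∃ e ∈ M.E, e ∉ H := by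
  by_contra! h
  have h1 := hH.2
  rw [eRk_eq_eRank (show M.E ⊆ H from h)] at h1
  have h2 := (ENat.lt_add_one_iff hr).2 le_rfl
  rw [h1] at h2
  exact lt_irrefl _ h2

theorem IsHyperplane.isNonloop (hH : M.IsHyperplane H) {e : α} (he : e ∈ M.E) (heH : e ∉ H) :
    M.IsNonloop e := by
  rw [← not_isLoop_iff]
  exact fun h => heH (hH.1.loops_subset h)

theorem IsStressedHyperplane.indep_of_encard_lt (hH : M.IsStressedHyperplane H)
    (hle : M.eRank ≤ H.encard) (hA : A ⊆ H) (hlt : A.encard < M.eRank) : M.Indep A := by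
  obtain ⟨S, hAS, hSH, hS⟩ := exists_superset_subset_encard_eq hA hlt.le hle
  refine (hH.2 S hSH hS).ssubset_indep (hAS.ssubset_of_ne ?_)
  rintro rfl
  exact hlt.ne hS

theorem IsStressedHyperplane.eRk_of_le_encard (hH : M.IsStressedHyperplane H) (hA : A ⊆ H)
    (hle : M.eRank ≤ A.encard) : M.eRk A = M.eRk H := by
  obtain ⟨S, hSA, hS⟩ := exists_subset_encard_eq hle
  have h1 := (hH.2 S (hSA.trans hA) hS).eRk_add_one_eq
  rw [hS, ← hH.1.2] at h1
  have h2 : M.eRk S = M.eRk H := (ENat.add_left_injective_of_ne_top (by simp : (1 : ℕ∞) ≠ ⊤)) h1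
  exact le_antisymm (M.eRk_mono hA) (h2 ▸ M.eRk_mono hSA)

theorem IsStressedHyperplane.contract (hH : M.IsStressedHyperplane H) (hF : F ⊆ H) (hle : M.eRank ≤ H.encard)
    (hlt : F.encard < M.eRank) : (M ／ F).IsStressedHyperplane (H \ F) := by
  have hFi := hH.indep_of_encard_lt hle hF hlt
  have hr := hFi.contract_eRank_add_encard
  have hFtop : F.encard ≠ ⊤ := hlt.ne_top
  have hHE := hH.1.1.subset_ground
  refine ⟨⟨?_, ?_⟩, ?_⟩
  · rw [isFlat_iff_closure_eq, contract_closure_eq, sdiff_union_of_subset hF, hH.1.1.closure]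
  · have h1 := hFi.contract_eRk_add_encard (sdiff_subset_sdiff_left hHE : H \ F ⊆ _)
    rw [sdiff_union_of_subset hF] at h1
    refine (ENat.add_left_injective_of_ne_top hFtop) ?_
    simp only
    rw [hr, ← hH.1.2, ← h1]
    ring
  · intro S hS hSr
    rw [subset_sdiff] at hS
    have h1 : (S ∪ F).encard = M.eRank := by
      rw [encard_union_eq hS.2, hSr, hr]
    have h2 := (hH.2 _ (union_subset hS.1 hF) h1).contract_sdiff_isCircuit (K := S) ?_
      subset_union_left
    · rwa [union_sdiff_left, hS.2.symm.sdiff_eq_left] at h2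
    · rw [nonempty_iff_ne_empty]
      rintro rfl
      rw [empty_union] at h1
      exact hlt.ne h1

variable [M.Finite]

theorem eRank_ne_top : M.eRank ≠ ⊤ := (eRank_ne_top_iff M).2 inferInstance

theorem IsStressedHyperplane.closure_of_le_encard (hH : M.IsStressedHyperplane H) (hA : A ⊆ H)
    (hle : M.eRank ≤ A.encard) : M.closure A = H := by
  rw [(M.isRkFinite_set A).closure_eq_closure_of_subset_of_eRk_ge_eRk hA
    (hH.eRk_of_le_encard hA hle).ge, hH.1.1.closure]

variable (hH : M.IsStressedHyperplane H)

theorem relax_ground : (M.relax H hH).E = M.E := rfl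

theorem relax_isBase_iff {B : Set α} :
    (M.relax H hH).IsBase B ↔ M.IsBase B ∨ (B ⊆ H ∧ B.encard = M.eRank) := Iff.rfl

theorem relax_indep_iff {I : Set α} :
    (M.relax H hH).Indep I ↔ M.Indep I ∨ (I ⊆ H ∧ I.encard = M.eRank) := by
  rw [indep_iff]
  constructor
  · rintro ⟨B, hB | hB, hIB⟩
    · exact Or.inl (hB.indep.subset hIB)
    · rcases eq_or_ne I B with rfl | hne
      · exact Or.inr hB
      · exact Or.inl ((hH.2 B hB.1 hB.2).ssubset_indep (hIB.ssubset_of_ne hne))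
  · rintro (hI | hI)
    · obtain ⟨B, hB, hIB⟩ := hI.exists_isBase_superset
      exact ⟨B, Or.inl hB, hIB⟩
    · exact ⟨I, Or.inr hI, Subset.rfl⟩

theorem relax_eRank : (M.relax H hH).eRank = M.eRank := by
  obtain ⟨B, hB⟩ := M.exists_isBase
  rw [← hB.encard_eq_eRank, ((relax_isBase_iff hH).2 (Or.inl hB)).encard_eq_eRank]

theorem eRk_le_relax_eRk (A : Set α) : M.eRk A ≤ (M.relax H hH).eRk A := by
  rw [eRk_le_iff]
  exact fun I hIA hI => ((relax_indep_iff hH).2 (Or.inl hI)).encard_le_eRk_of_subset hIA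

theorem relax_eRk_of_le_encard (hA : A ⊆ H) (hle : M.eRank ≤ A.encard) :
    (M.relax H hH).eRk A = M.eRank := by
  refine le_antisymm ((eRk_le_eRank _ _).trans (relax_eRank hH).le) ?_
  obtain ⟨S, hSA, hS⟩ := exists_subset_encard_eq hle
  rw [← hS]
  exact ((relax_indep_iff hH).2 (Or.inr ⟨hSA.trans hA, hS⟩)).encard_le_eRk_of_subset hSA

/-- If `A` contains a new base `I`, it also contains some `e` outside `H`. As `I` spans `H` in `M`,
adding `e` already gives full rank in `M`. -/
theorem relax_eRk_eq (hAE : A ⊆ M.E) (h : ¬ (A ⊆ H ∧ M.eRank ≤ A.encard)) :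
    (M.relax H hH).eRk A = M.eRk A := by
  refine le_antisymm ?_ (eRk_le_relax_eRk hH A)
  rw [eRk_le_iff]
  intro I hIA hI
  rcases (relax_indep_iff hH).1 hI with hI | ⟨hIH, hI⟩
  · exact hI.encard_le_eRk_of_subset hIA
  · obtain ⟨e, heA, heH⟩ : ∃ e ∈ A, e ∉ H := by
      rw [← not_subset]
      exact fun hAH => h ⟨hAH, hI ▸ encard_le_encard hIA⟩
    have h1 := M.eRk_insert_eq_add_one (X := I) (e := e)
      ⟨hAE heA, by rwa [hH.closure_of_le_encard hIH hI.ge]⟩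
    rw [hH.eRk_of_le_encard hIH hI.ge, hH.1.2] at h1
    rw [hI, ← h1]
    exact M.eRk_mono (insert_subset heA hIA)

theorem relax_restrict_eq (hAE : A ⊆ M.E) (hAH : ¬ A ⊆ H) (hr : M.eRk A < M.eRank) :
    M.relax H hH ↾ A = M ↾ A := by
  refine ext_indep rfl fun I hI => ?_
  rw [restrict_ground_eq] at hI
  rw [restrict_indep_iff, restrict_indep_iff, relax_indep_iff]
  refine ⟨?_, fun h => ⟨Or.inl h.1, h.2⟩⟩
  rintro ⟨h | h, -⟩
  · exact ⟨h, hI⟩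
  · have h1 := ((relax_indep_iff hH).2 (Or.inr h)).encard_le_eRk_of_subset hI
    rw [relax_eRk_eq hH hAE (fun h => hAH h.1), h.2] at h1
    exact absurd hr (not_lt.2 h1)

/-- Contract through a basis of `A` that contains an element outside `H`: no new base contains that
element. -/
theorem relax_contract_eq (hAE : A ⊆ M.E) (hAH : ¬ A ⊆ H) :
    M.relax H hH ／ A = M ／ A := by
  obtain ⟨e, heA, heH⟩ := not_subset.1 hAH
  obtain ⟨I, hI, heI⟩ := (hH.1.isNonloop (hAE heA) heH).indep.subset_isBasis_of_subset
    (singleton_subset_iff.2 heA) hAE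
  rw [singleton_subset_iff] at heI
  have key : ∀ J : Set α, I ⊆ J → ((M.relax H hH).Indep J ↔ M.Indep J) := by
    intro J hIJ
    rw [relax_indep_iff, or_iff_left]
    exact fun h => heH (h.1 (hIJ heI))
  have hI' : (M.relax H hH).IsBasis I A := by
    rw [isBasis_iff_indep_encard_eq_of_finite (M := M.relax H hH) (M.ground_finite.subset hI.indep.subset_ground) hAE]
    refine ⟨hI.subset, (key I Subset.rfl).2 hI.indep, ?_⟩
    rw [relax_eRk_eq hH hAE (fun h => hAH h.1), hI.encard_eq_eRk]
  refine ext_indep rfl fun J _ => ?_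
  rw [hI.contract_indep_iff, hI'.contract_indep_iff, key _ subset_union_right]

theorem relax_contract_eq_relax (hF : F ⊆ H) (hle : M.eRank ≤ H.encard)
    (hlt : F.encard < M.eRank) :
    M.relax H hH ／ F = (M ／ F).relax (H \ F) (hH.contract hF hle hlt) := by
  have hFi := hH.indep_of_encard_lt hle hF hlt
  have hFi' : (M.relax H hH).Indep F := (relax_indep_iff hH).2 (Or.inl hFi)
  have hr := hFi.contract_eRank_add_encard
  refine ext_indep rfl fun J hJ => ?_
  rw [contract_ground, subset_sdiff] at hJ
  rw [hFi'.contract_indep_iff, relax_indep_iff, relax_indep_iff, hFi.contract_indep_iff,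
    and_iff_right hJ.2, and_iff_right hJ.2, union_subset_iff, subset_sdiff, and_iff_left hF,
    and_iff_left hJ.2, encard_union_eq hJ.2, ← hr,
    (ENat.add_left_injective_of_ne_top hlt.ne_top).eq_iff]

end Matroid

/-! ### The Kazhdan–Lusztig recursion over all subsets -/

theorem finsum_mem_powerset_eq_sum {α R : Type*} [AddCommMonoid R] {S : Set α} (hS : S.Finite)
    (f : Set α → R) : ∑ᶠ A ∈ 𝒫 S, f A = ∑ A ∈ hS.toFinset.powerset, f A := by
  classical
  have h : 𝒫 S = ((hS.toFinset.powerset.image fun A : Finset α => (A : Set α)) : Set (Set α)) := by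
    ext A
    simp only [mem_powerset_iff, Finset.coe_image, mem_image, Finset.mem_coe, Finset.mem_powerset]
    constructor
    · intro hA
      exact ⟨(hS.subset hA).toFinset, by simpa using hA, by simp⟩
    · rintro ⟨B, hB, rfl⟩
      intro x hx
      simpa using hB hx
  rw [h, finsum_mem_coe_finset, Finset.sum_image]
  exact fun A _ B _ hAB => Finset.coe_injective hAB

namespace Matroid

theorem coeff_lowerHalf (r : ℕ) (P : ℤ[X]) (m : ℕ) :
    (lowerHalf r P).coeff m = if 2 * m < r then P.coeff m else 0 := by
  rw [lowerHalf, finsetSum_coeff]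
  simp only [coeff_monomial]
  rw [Finset.sum_ite_eq']
  refine if_congr ?_ rfl rfl
  rw [Finset.mem_filter, Finset.mem_range]
  omega

variable {α : Type*} {M : Matroid α} {H A F : Set α}

theorem klPoly_congr {M N : Matroid α} [M.Finite] [N.Finite] (h : M = N) :
    klPoly M = klPoly N := by
  subst h
  rfl

theorem charPoly_restrict_eq_sum (hA : A.Finite) :
    charPoly (M ↾ A) = ∑ B ∈ hA.toFinset.powerset,
      (-1) ^ B.card * X ^ (M.natRk A - M.natRk B) := by
  rw [charPoly]
  have h := finsum_mem_powerset_eq_sum hA fun B : Set α =>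
    ((-1) ^ B.ncard * X ^ ((M ↾ A).natRank - (M ↾ A).natRk B) : ℤ[X])
  rw [show (M ↾ A).E = A from rfl, h]
  refine Finset.sum_congr rfl fun B hB => ?_
  have hB' : (B : Set α) ⊆ A := by
    intro x hx
    simpa using Finset.mem_powerset.1 hB hx
  rw [ncard_coe_finset, natRank, eRank_restrict, natRk, natRk, natRk, restrict_eRk_eq M hB']

theorem Indep.charPoly_restrict (hA : M.Indep A) (hfin : A.Finite) :
    charPoly (M ↾ A) = (X - 1) ^ A.ncard := by
  rw [charPoly_restrict_eq_sum hfin, sub_eq_neg_add,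
    ncard_eq_toFinset_card A hfin, ← Finset.sum_pow_mul_eq_add_pow]
  refine Finset.sum_congr rfl fun B hB => ?_
  have hB' : (B : Set α) ⊆ A := by
    intro x hx
    simpa using Finset.mem_powerset.1 hB hx
  rw [natRk, natRk, hA.eRk_eq_encard, (hA.subset hB').eRk_eq_encard, ← ncard_def, ← ncard_def,
    ncard_coe_finset, ncard_eq_toFinset_card A hfin]

variable [M.Finite]

theorem klPoly_empty (h : M.E = ∅) : klPoly M = 1 := by
  have h0 : M.eRank = 0 := by
    rw [← eRk_ground, h, eRk_empty]
  rw [klPoly, if_pos h0, if_pos h]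

theorem klPoly_eq_zero {e : α} (he : M.IsLoop e) : klPoly M = 0 := by
  rw [klPoly]
  have hE : M.E ≠ ∅ := fun h => notMem_empty e (h ▸ he.mem_ground)
  split_ifs
  · rfl
  · have h : ∀ F : {F : Set α // M.IsFlat F ∧ F.Nonempty},
        charPoly (M ↾ F.1) * klPoly (M ／ F.1) = 0 := by
      rintro ⟨F, hF, -⟩
      have hfin : (M ↾ F).Finite := M.restrict_finite (M.ground_finite.subset hF.subset_ground)
      rw [charPoly_eq_zero (M ↾ F) (e := e), zero_mul]
      rw [restrict_isLoop_iff]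
      exact ⟨hF.loops_subset he, Or.inl he⟩
    rw [finsum_congr h]
    simp [lowerHalf]

theorem klPoly_contract_eq_zero (hAE : A ⊆ M.E) (hA : M.closure A ≠ A) : klPoly (M ／ A) = 0 := by
  obtain ⟨e, he, heA⟩ := not_subset.1 fun h => hA (h.antisymm (M.subset_closure A hAE))
  exact klPoly_eq_zero (contract_isLoop_iff_mem_closure.2 ⟨he, heA⟩)

/-- Flats differ between a matroid and its relaxation; summing over all subsets gives both
recursions the same index set. -/
theorem klPoly_eq_lowerHalf (hr : M.eRank ≠ 0) :
    klPoly M = -lowerHalf M.natRank (∑ A ∈ M.ground_finite.toFinset.powerset,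
      if A.Nonempty then charPoly (M ↾ (A : Set α)) * klPoly (M ／ (A : Set α)) else 0) := by
  classical
  have h := finsum_mem_powerset_eq_sum M.ground_finite fun A : Set α =>
    if A.Nonempty then charPoly (M ↾ A) * klPoly (M ／ A) else 0
  simp only [Finset.coe_nonempty] at h
  rw [klPoly, if_neg hr, ← h]
  congr 2
  rw [finsum_subtype_eq_finsum_cond (p := fun F => M.IsFlat F ∧ F.Nonempty)
    (f := fun F => charPoly (M ↾ F) * klPoly (M ／ F))]
  refine finsum_congr fun A => ?_
  rw [finsum_eq_if, finsum_eq_if, mem_powerset_iff]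
  by_cases hAE : A ⊆ M.E
  · by_cases hA : A.Nonempty
    · by_cases hF : M.IsFlat A
      · simp [hF, hA, hAE]
      · rw [isFlat_iff_closure_eq] at hF
        simp [klPoly_contract_eq_zero hAE hF]
    · simp [hA]
  · have : ¬ M.IsFlat A := fun h => hAE h.subset_ground
    simp [this, hAE]

theorem klPoly_contract_ground : klPoly (M ／ M.E) = 1 := klPoly_empty (by simp)

/-- Every nonempty set spans, so only the ground set contributes, with characteristic polynomial `X
- 1`. -/
theorem klPoly_of_eRank_one [M.Loopless] (hr : M.eRank = 1) : klPoly M = 1 := by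
  classical
  have hne : M.E ≠ ∅ := by
    intro h
    rw [← eRk_ground, h, eRk_empty] at hr
    exact zero_ne_one hr
  have hrk : ∀ A : Finset α, (A : Set α) ⊆ M.E → M.eRk A = if A = ∅ then 0 else 1 := by
    intro A hA
    split_ifs with h
    · simp [h]
    · obtain ⟨e, he⟩ := Finset.nonempty_iff_ne_empty.2 h
      refine le_antisymm (hr ▸ M.eRk_le_eRank _) ?_
      rw [← eRk_singleton_eq (hA he)]
      exact M.eRk_mono (by simpa using he)
  have hterm : ∀ A ∈ M.ground_finite.toFinset.powerset,
      (if A.Nonempty then charPoly (M ↾ (A : Set α)) * klPoly (M ／ (A : Set α)) else 0) =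
        if A = M.ground_finite.toFinset then charPoly (M ↾ M.E) else 0 := by
    intro A hA
    have hAE : (A : Set α) ⊆ M.E := fun x hx => by simpa using Finset.mem_powerset.1 hA hx
    by_cases h : A = M.ground_finite.toFinset
    · subst h
      rw [if_pos (by simpa [nonempty_iff_ne_empty] using hne), if_pos rfl,
        Finite.coe_toFinset, klPoly_contract_ground, mul_one]
    · rw [if_neg h]
      split_ifs with hA0
      · rw [klPoly_contract_eq_zero hAE, mul_zero]
        intro hcl
        have hs : M.Spanning (A : Set α) := by
          rw [spanning_iff_eRk_le hAE, hrk A hAE, if_neg hA0.ne_empty, hr]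
        rw [hs.closure_eq] at hcl
        exact h (Finset.coe_injective (by simp [hcl]))
      · rfl
  have hchi : charPoly (M ↾ M.E) = X - 1 := by
    have h1 : ∀ B ∈ M.ground_finite.toFinset.powerset,
        ((-1) ^ B.card * X ^ (M.natRk M.E - M.natRk B) : ℤ[X]) =
          (((-1) ^ B.card : ℤ) : ℤ[X]) + if B = ∅ then X - 1 else 0 := by
      intro B hB
      have hBE : (B : Set α) ⊆ M.E := fun x hx => by simpa using Finset.mem_powerset.1 hB hx
      rw [natRk, natRk, eRk_ground, hr, hrk B hBE]
      split_ifs with h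
      · simp [h]
      · simp
    rw [charPoly_restrict_eq_sum M.ground_finite, Finset.sum_congr rfl h1, Finset.sum_add_distrib,
      ← Int.cast_sum, Finset.sum_powerset_neg_one_pow_card, if_neg (by simpa using hne),
      Finset.sum_ite_eq', if_pos (by simp)]
    simp
  rw [klPoly_eq_lowerHalf (by simp [hr]), Finset.sum_congr rfl hterm, Finset.sum_ite_eq',
    if_pos (by simp), hchi, natRank, hr]
  ext m
  rw [coeff_neg, coeff_lowerHalf]
  rcases m with _ | m
  · simp
  · rw [if_neg (by simp), coeff_one, if_neg (by omega)]
    simp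

theorem IsHyperplane.klPoly_contract (hH : M.IsHyperplane H) : klPoly (M ／ H) = 1 := by
  have hloop : (M ／ H).Loopless := by
    rw [loopless_iff, contract_loops_eq, hH.1.closure, sdiff_self]
  refine klPoly_of_eRank_one (le_antisymm ?_ ?_)
  · obtain ⟨J, hJ⟩ := (M ／ H).exists_isBase
    obtain ⟨I, hI⟩ := M.exists_isBasis H hH.1.subset_ground
    have h1 := hI.contract_indep_iff.1 hJ.indep
    have h2 := h1.1.encard_le_eRank
    rw [encard_union_eq (disjoint_of_subset_right hI.subset h1.2.symm), hI.encard_eq_eRk,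
      ← hH.2, add_comm] at h2
    have h3 : M.eRk H ≠ ⊤ := ((M.eRk_le_eRank H).trans_lt eRank_ne_top.lt_top).ne
    rw [← hJ.encard_eq_eRank]
    exact (ENat.add_le_add_iff_left h3).1 h2
  · obtain ⟨e, heE, heH⟩ := hH.exists_notMem eRank_ne_top
    rw [← eRk_singleton_eq (M := M ／ H) (e := e) ⟨heE, heH⟩]
    exact eRk_le_eRank _ _

end Matroid

/-! ### The effect of relaxation on the recursion -/

theorem binomialShift_eq_sum_range_add {R : Type*} [CommRing R] {f : ℕ → R} (hf : f 0 = 0)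
    (d : ℕ) (s : R) (k : ℕ) :
    binomialShift d s f k = ∑ j ∈ Finset.range (k + d + 1), (k + d).choose j * s ^ j * f (k - j) := by
  refine Finset.sum_subset (Finset.range_subset_range.2 (by omega)) fun j _ hj => ?_
  rw [Finset.mem_range] at hj
  rw [show k - j = 0 by omega, hf, mul_zero]

theorem sum_powerset_ite_subset {α R : Type*} [AddCommMonoid R] {E H : Set α} (hE : E.Finite)
    (hHE : H ⊆ E) [∀ A : Finset α, Decidable ((A : Set α) ⊆ H)] (f : Finset α → R) :
    (∑ A ∈ hE.toFinset.powerset, if (A : Set α) ⊆ H then f A else 0) =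
      ∑ A ∈ (hE.subset hHE).toFinset.powerset, f A := by
  rw [← Finset.sum_filter]
  refine Finset.sum_congr ?_ fun _ _ => rfl
  ext A
  simp only [Finset.mem_filter, Finset.mem_powerset, Finite.subset_toFinset]
  exact ⟨fun h => h.2, fun h => ⟨h.trans hHE, h⟩⟩

namespace Matroid

variable {α : Type*} {M : Matroid α} {H : Set α} [M.Finite]

/-- Only subsets of `H` with at least `k` elements change rank, from `k - 1` to `k`. With the
expansion of the polynomial of `M ↾ H`, everything is a sum over subsets of `H` depending on
cardinality. -/
theorem charPoly_relax (hH : M.IsStressedHyperplane H) {k d : ℕ} (hk : M.eRank = k)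
    (hh : H.encard = (k + d : ℕ)) :
    charPoly (M.relax H hH ↾ M.E) - charPoly (M ↾ M.E) - charPoly (M ↾ H) =
      -binomialShift d (-1) klRelaxDefect k := by
  classical
  have hHE := hH.1.1.subset_ground
  have hHfin := M.ground_finite.subset hHE
  have hle : M.eRank ≤ H.encard := by
    rw [hk, hh]
    exact_mod_cast Nat.le_add_right k d
  have hrH : M.eRk H + 1 = k := hH.1.2.trans hk
  have hk1 : 1 ≤ k := by
    have : (1 : ℕ∞) ≤ k := hrH ▸ le_add_self
    exact_mod_cast this
  have hrH' : M.eRk H = (k - 1 : ℕ) := by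
    refine (ENat.add_left_injective_of_ne_top (by simp : (1 : ℕ∞) ≠ ⊤)) ?_
    simp only
    rw [hrH]
    norm_cast
    omega
  have hcardH : hHfin.toFinset.card = k + d := by
    rw [hHfin.encard_eq_coe_toFinset_card] at hh
    exact_mod_cast hh
  have e1 : charPoly (M.relax H hH ↾ M.E) - charPoly (M ↾ M.E) =
      ∑ B ∈ hHfin.toFinset.powerset, if k ≤ B.card then (-1) ^ B.card * (1 - X : ℤ[X]) else 0 := by
    rw [charPoly_restrict_eq_sum M.ground_finite, charPoly_restrict_eq_sum M.ground_finite,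
      ← Finset.sum_sub_distrib, ← sum_powerset_ite_subset M.ground_finite hHE]
    refine Finset.sum_congr rfl fun B hB => ?_
    have hBE : (B : Set α) ⊆ M.E := fun x hx => by simpa using Finset.mem_powerset.1 hB hx
    have hE : (M.relax H hH).natRk M.E = k := by
      rw [natRk, ← relax_ground hH, eRk_ground, relax_eRank, hk]
      simp
    rw [hE, natRk, natRk, natRk, eRk_ground, hk, ← mul_sub]
    by_cases h : (B : Set α) ⊆ H ∧ k ≤ B.card
    · have hB : M.eRank ≤ (B : Set α).encard := by
        rw [hk, encard_coe_eq_coe_finsetCard]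
        exact_mod_cast h.2
      rw [relax_eRk_of_le_encard hH h.1 hB, hH.eRk_of_le_encard h.1 hB, if_pos h.1, if_pos h.2,
        hrH', hk]
      simp only [ENat.toNat_natCast]
      rw [Nat.sub_self, show k - (k - 1) = 1 by omega, pow_zero, pow_one]
    · rw [relax_eRk_eq hH hBE, ENat.toNat_natCast, sub_self, mul_zero]
      · split_ifs with h1 h2
        · exact absurd ⟨h1, h2⟩ h
        · rfl
        · rfl
      · rw [hk, encard_coe_eq_coe_finsetCard]
        exact_mod_cast h
  have e2 : charPoly (M ↾ H) = ∑ B ∈ hHfin.toFinset.powerset,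
      (-1) ^ B.card * (if k ≤ B.card then 1 else X ^ (k - 1 - B.card)) := by
    rw [charPoly_restrict_eq_sum hHfin]
    refine Finset.sum_congr rfl fun B hB => ?_
    have hBH : (B : Set α) ⊆ H := fun x hx => by simpa using Finset.mem_powerset.1 hB hx
    rw [natRk, natRk, hrH']
    split_ifs with h
    · rw [hH.eRk_of_le_encard hBH, hrH']
      · simp
      · rw [hk, encard_coe_eq_coe_finsetCard]
        exact_mod_cast h
    · rw [(hH.indep_of_encard_lt hle hBH _).eRk_eq_encard, encard_coe_eq_coe_finsetCard,
        ENat.toNat_natCast, ENat.toNat_natCast]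
      · rw [hk, encard_coe_eq_coe_finsetCard]
        exact_mod_cast not_le.1 h
  -- The last term, `X` times a sign, sums to zero over the subsets of the nonempty set `H`.
  have e3 : ∀ B ∈ hHfin.toFinset.powerset,
      ((if k ≤ B.card then (-1) ^ B.card * (1 - X : ℤ[X]) else 0) -
        (-1) ^ B.card * (if k ≤ B.card then 1 else X ^ (k - 1 - B.card))) =
      -((-1) ^ B.card * klRelaxDefect (k - B.card)) - X * (((-1) ^ B.card : ℤ) : ℤ[X]) := by
    intro B _
    rw [klRelaxDefect]
    split_ifs with h1 h2 h2
    · push_cast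
      ring
    · omega
    · omega
    · rw [show k - 1 - B.card = k - B.card - 1 by omega]
      push_cast
      ring
  have hne : hHfin.toFinset ≠ ∅ := by
    rw [← Finset.card_pos.trans Finset.nonempty_iff_ne_empty, hcardH]
    omega
  rw [e1, e2, ← Finset.sum_sub_distrib, Finset.sum_congr rfl e3, Finset.sum_sub_distrib,
    ← Finset.mul_sum, ← Int.cast_sum, Finset.sum_powerset_neg_one_pow_card, if_neg hne,
    Int.cast_zero, mul_zero, sub_zero, Finset.sum_neg_distrib,
    Finset.sum_powerset_apply_card (fun j => (-1) ^ j * klRelaxDefect (k - j)), hcardH,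
    binomialShift_eq_sum_range_add (by simp [klRelaxDefect])]
  simp only [nsmul_eq_mul, mul_assoc]

/-- If `A ⊆ H` is small, it is independent and induction applies. If `A ⊆ H` is large, it spans the
relaxation and has closure `H` in `M`, so only `A = H` counts, and only in `M`. If `A` is not inside
`H`, the contractions agree; the restrictions agree too unless `A` spans, and a proper spanning set
contributes zero. -/
theorem klPoly_relax_term (hH : M.IsStressedHyperplane H) {k d : ℕ} (hk : M.eRank = k)
    (hh : H.encard = (k + d : ℕ)) {A : Set α} (hAE : A ⊆ M.E) (hA : A.Nonempty)
    (ih : ∀ (hAH : A ⊆ H) (hle : M.eRank ≤ H.encard) (hlt : A.encard < M.eRank),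
      klPoly ((M ／ A).relax (H \ A) (hH.contract hAH hle hlt)) =
        klPoly (M ／ A) + klRelaxPoly d (k - A.ncard)) [Decidable (A = M.E)]
    [Decidable (A = H)] [Decidable (A ⊆ H)] :
    charPoly (M.relax H hH ↾ A) * klPoly (M.relax H hH ／ A) -
      charPoly (M ↾ A) * klPoly (M ／ A) =
    (if A = M.E then charPoly (M.relax H hH ↾ M.E) - charPoly (M ↾ M.E) else 0) -
      (if A = H then charPoly (M ↾ H) else 0) +
      if A ⊆ H then (X - 1) ^ A.ncard * klRelaxPoly d (k - A.ncard) else 0 := by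
  have hHE := hH.1.1.subset_ground
  have hAfin := M.ground_finite.subset hAE
  have hle : M.eRank ≤ H.encard := by
    rw [hk, hh]
    exact_mod_cast Nat.le_add_right k d
  obtain ⟨e, heE, heH⟩ := hH.1.exists_notMem eRank_ne_top
  by_cases hAH : A ⊆ H
  · rw [if_neg (fun h : A = M.E => heH (hAH (h ▸ heE))), if_pos hAH]
    rcases lt_or_ge A.encard M.eRank with hlt | hge
    · have hAi := hH.indep_of_encard_lt hle hAH hlt
      have hAi' := (relax_indep_iff hH).2 (Or.inl hAi)
      rw [if_neg (by rintro rfl; exact not_lt.2 hle hlt), hAi.charPoly_restrict hAfin,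
        hAi'.charPoly_restrict hAfin, klPoly_congr (relax_contract_eq_relax hH hAH hle hlt),
        ih hAH hle hlt]
      ring
    · have hk0 : k - A.ncard = 0 := by
        rw [hk, ← hAfin.cast_ncard_eq] at hge
        have : k ≤ A.ncard := by exact_mod_cast hge
        omega
      have hs : (M.relax H hH).Spanning A := by
        rw [spanning_iff_eRk_le (M := M.relax H hH) hAE, relax_eRk_of_le_encard hH hAH hge, relax_eRank]
      rw [hk0, klRelaxPoly_zero, klPoly_contract_eq_zero (M := M.relax H hH) hAE]
      · split_ifs with h
        · subst h
          rw [hH.1.klPoly_contract]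
          ring
        · rw [klPoly_contract_eq_zero hAE]
          · ring
          · rw [hH.closure_of_le_encard hAH hge]
            exact fun h' => h h'.symm
      · rw [hs.closure_eq]
        intro h
        exact heH (hAH (h ▸ heE))
  · rw [if_neg hAH, if_neg (fun h : A = H => hAH h.subset), klPoly_congr (relax_contract_eq hH hAE hAH)]
    split_ifs with h
    · subst h
      rw [klPoly_contract_ground]
      ring
    · rcases (M.eRk_le_eRank A).lt_or_eq with hlt | heq
      · rw [relax_restrict_eq hH hAE hAH hlt]
        ring
      · rw [klPoly_contract_eq_zero hAE]
        · ring
        · rw [((spanning_iff_eRk_le hAE).2 heq.ge).closure_eq]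
          exact fun h' => h h'.symm

/-- Strong induction on the rank with `d` fixed: contracting `A ⊆ H` lowers rank and cardinality of
the hyperplane equally. -/
theorem klPoly_relax {α : Type*} (d k : ℕ) (M : Matroid α) [M.Finite] (H : Set α)
    (hH : M.IsStressedHyperplane H) (hk : M.eRank = k) (hh : H.encard = (k + d : ℕ)) :
    klPoly (M.relax H hH) = klPoly M + klRelaxPoly d k := by
  classical
  induction k using Nat.strong_induction_on generalizing M H with
  | _ k ihk
  have hHE := hH.1.1.subset_ground
  have hHfin := M.ground_finite.subset hHE
  have hk1 : 1 ≤ k := by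
    have : (1 : ℕ∞) ≤ k := by
      rw [← hk, ← hH.1.2]
      exact le_add_self
    exact_mod_cast this
  have hr0 : M.eRank ≠ 0 := by
    rw [hk]
    exact_mod_cast (by omega : k ≠ 0)
  have hcardH : hHfin.toFinset.card = k + d := by
    rw [hHfin.encard_eq_coe_toFinset_card] at hh
    exact_mod_cast hh
  have hHne : hHfin.toFinset.Nonempty := by
    rw [← Finset.card_pos, hcardH]
    omega
  have hHne' : H.Nonempty := by simpa using hHne
  have hterm : ∀ A ∈ M.ground_finite.toFinset.powerset,
      ((if A.Nonempty then charPoly (M.relax H hH ↾ (A : Set α)) *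
          klPoly (M.relax H hH ／ (A : Set α)) else 0) -
        (if A.Nonempty then charPoly (M ↾ (A : Set α)) * klPoly (M ／ (A : Set α)) else 0)) =
      ((if A = M.ground_finite.toFinset then
          charPoly (M.relax H hH ↾ M.E) - charPoly (M ↾ M.E) else 0) -
        (if A = hHfin.toFinset then charPoly (M ↾ H) else 0)) +
        ((if (A : Set α) ⊆ H then (X - 1) ^ A.card * klRelaxPoly d (k - A.card) else 0) -
          if A = ∅ then klRelaxPoly d k else 0) := by
    intro A hA
    have hAE : (A : Set α) ⊆ M.E := fun x hx => by simpa using Finset.mem_powerset.1 hA hx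
    have c1 : A = M.ground_finite.toFinset ↔ (A : Set α) = M.E := by
      rw [← Finset.coe_inj, Finite.coe_toFinset]
    have c2 : A = hHfin.toFinset ↔ (A : Set α) = H := by
      rw [← Finset.coe_inj, Finite.coe_toFinset]
    rcases A.eq_empty_or_nonempty with rfl | hAne
    · have h1 : (∅ : Set α) ≠ M.E := (hHne'.mono hHE).ne_empty.symm
      have h2 : (∅ : Set α) ≠ H := hHne'.ne_empty.symm
      simp only [c1, c2, Finset.coe_empty, h1, h2]
      simp
    · rw [if_pos hAne, if_pos hAne, if_neg hAne.ne_empty, klPoly_relax_term hH hk hh hAE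
        (by simpa using hAne)]
      · simp only [c1, c2, ncard_coe_finset, sub_zero]
      · intro hAH hle hlt
        rw [ncard_coe_finset]
        have hc := hlt
        rw [hk, encard_coe_eq_coe_finsetCard] at hc
        have hc' : A.card < k := by exact_mod_cast hc
        refine ihk (k - A.card) (by have := hAne.card_pos; omega) _ _ _ ?_ ?_
        · have h1 := (hH.indep_of_encard_lt hle hAH hlt).contract_eRank_add_encard
          rw [hk, encard_coe_eq_coe_finsetCard] at h1
          refine (ENat.add_left_injective_of_ne_top (ENat.natCast_ne_top A.card)) ?_
          simp only
          rw [h1]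
          norm_cast
          omega
        · have h1 := encard_sdiff_add_encard_of_subset hAH
          rw [hh, encard_coe_eq_coe_finsetCard] at h1
          refine (ENat.add_left_injective_of_ne_top (ENat.natCast_ne_top A.card)) ?_
          simp only
          rw [h1]
          norm_cast
          omega
  have hsum := Finset.sum_congr rfl hterm
  rw [Finset.sum_sub_distrib, Finset.sum_add_distrib, Finset.sum_sub_distrib,
    Finset.sum_sub_distrib, Finset.sum_ite_eq', if_pos (by simp), Finset.sum_ite_eq',
    if_pos (by simpa using hHE), sum_powerset_ite_subset M.ground_finite hHE,
    Finset.sum_ite_eq', if_pos (by simp), charPoly_relax hH hk hh,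
    Finset.sum_powerset_apply_card (fun j => (X - 1) ^ j * klRelaxPoly d (k - j)), hcardH] at hsum
  simp only [nsmul_eq_mul, ← mul_assoc] at hsum
  rw [← binomialShift_eq_sum_range_add (klRelaxPoly_zero d)] at hsum
  have hN := klPoly_eq_lowerHalf (M := M.relax H hH) (by rwa [relax_eRank])
  rw [show (M.relax H hH).ground_finite.toFinset = M.ground_finite.toFinset from rfl] at hN
  rw [klPoly_eq_lowerHalf hr0, hN, natRank, natRank, relax_eRank, hk, ENat.toNat_natCast]
  ext m
  have hm := congrArg (fun P : ℤ[X] => P.coeff m) hsum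
  simp only [coeff_sub, coeff_add, coeff_neg] at hm
  simp only [coeff_add, coeff_neg, coeff_lowerHalf]
  split_ifs with h
  · rw [coeff_binomialShift_klRelaxPoly h] at hm
    linear_combination -hm
  · rw [coeff_klRelaxPoly_eq_zero (by omega)]
    simp

end Matroid

/-! ### A matroid with a stressed hyperplane of given size -/

namespace Matroid

/-- The matroid on a finite type in which `x` is a coloop whose deletion is uniform of
rank `r`. -/
def uniformWithColoop {α : Type*} [Finite α] (x : α) (r : ℕ) : Matroid α :=
  (IndepMatroid.ofFinite (E := univ) finite_univ (fun I => (I \ {x}).ncard ≤ r)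
    (by simp)
    (fun I J hJ hIJ => (ncard_le_ncard (sdiff_subset_sdiff_left hIJ)).trans hJ)
    (by
      intro I J hI hJ hlt
      by_cases hx : x ∈ J ∧ x ∉ I
      · refine ⟨x, hx.1, hx.2, ?_⟩
        rwa [insert_sdiff_of_mem _ (mem_singleton x)]
      · have hcard : (I \ {x}).ncard < (J \ {x}).ncard := by
          by_cases hxJ : x ∈ J
          · have hxI : x ∈ I := by tauto
            have h1 := ncard_sdiff_singleton_add_one hxI
            have h2 := ncard_sdiff_singleton_add_one hxJ
            omega
          · rw [sdiff_singleton_eq_self hxJ]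
            exact (ncard_le_ncard sdiff_subset).trans_lt hlt
        obtain ⟨e, he, heI⟩ := exists_mem_notMem_of_ncard_lt_ncard hcard
        refine ⟨e, he.1, fun h => heI ⟨h, he.2⟩, ?_⟩
        rw [insert_sdiff_of_notMem _ he.2]
        exact (ncard_insert_le _ _).trans (by omega))
    (fun _ _ => subset_univ _)).matroid

theorem uniformWithColoop_indep_iff {α : Type*} [Finite α] {x : α} {r : ℕ} {I : Set α} :
    (uniformWithColoop x r).Indep I ↔ (I \ {x}).ncard ≤ r := by
  simp [uniformWithColoop]

theorem uniformWithColoop_ground {α : Type*} [Finite α] (x : α) (r : ℕ) :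
    (uniformWithColoop x r).E = univ := rfl

instance uniformWithColoop_finite {α : Type*} [Finite α] (x : α) (r : ℕ) :
    (uniformWithColoop x r).Finite := ⟨finite_univ⟩

theorem uniformWithColoop_eRk_compl {α : Type*} [Finite α] (x : α) {r : ℕ}
    (hr : r ≤ ({x}ᶜ : Set α).ncard) : (uniformWithColoop x r).eRk {x}ᶜ = r := by
  refine le_antisymm ?_ ?_
  · rw [eRk_le_iff]
    intro I hI hIi
    rw [uniformWithColoop_indep_iff, sdiff_singleton_eq_self fun h => hI h rfl] at hIi
    rw [← I.toFinite.cast_ncard_eq]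
    exact_mod_cast hIi
  · obtain ⟨S, hS, hSr⟩ := exists_subset_card_eq hr
    rw [le_eRk_iff]
    refine ⟨S, hS, uniformWithColoop_indep_iff.2 ((ncard_le_ncard sdiff_subset).trans hSr.le), ?_⟩
    rw [← S.toFinite.cast_ncard_eq, hSr]

theorem uniformWithColoop_eRank {α : Type*} [Finite α] (x : α) {r : ℕ}
    (hr : r ≤ ({x}ᶜ : Set α).ncard) : (uniformWithColoop x r).eRank = (r + 1 : ℕ) := by
  rw [← eRk_ground]
  refine le_antisymm ?_ ?_
  · rw [eRk_le_iff]
    intro I _ hIi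
    rw [uniformWithColoop_indep_iff] at hIi
    rw [← I.toFinite.cast_ncard_eq]
    have := ncard_le_ncard_sdiff_add_ncard I {x}
    rw [ncard_singleton] at this
    exact_mod_cast this.trans (by omega)
  · obtain ⟨S, hS, hSr⟩ := exists_subset_card_eq hr
    have hxS : x ∉ S := fun h => hS h rfl
    rw [le_eRk_iff]
    refine ⟨insert x S, subset_univ _, uniformWithColoop_indep_iff.2 ?_, ?_⟩
    · rw [insert_sdiff_of_mem _ (mem_singleton x)]
      exact (ncard_le_ncard sdiff_subset).trans hSr.le
    · rw [← (insert x S).toFinite.cast_ncard_eq, ncard_insert_of_notMem hxS, hSr]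

theorem uniformWithColoop_isStressedHyperplane {α : Type*} [Finite α] (x : α) {r : ℕ}
    (hr : r ≤ ({x}ᶜ : Set α).ncard) : (uniformWithColoop x r).IsStressedHyperplane {x}ᶜ := by
  refine ⟨⟨?_, ?_⟩, ?_⟩
  · rw [isFlat_iff_closure_eq]
    refine Subset.antisymm ?_ (subset_closure _ _ (subset_univ _))
    rintro y hy rfl
    -- If the coloop lay in the closure of its complement, the ground set would have rank `r`
    -- instead of `r + 1`.
    have h1 := (uniformWithColoop y r).eRk_mono
      (insert_subset hy (subset_closure _ {y}ᶜ (subset_univ _)))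
    rw [insert_eq, union_compl_self, ← uniformWithColoop_ground y r, eRk_ground, eRk_closure_eq,
      uniformWithColoop_eRank y hr, uniformWithColoop_eRk_compl y hr, Nat.cast_le] at h1
    omega
  · rw [uniformWithColoop_eRk_compl x hr, uniformWithColoop_eRank x hr, Nat.cast_add, Nat.cast_one]
  · intro S hS hSr
    rw [uniformWithColoop_eRank x hr, ← S.toFinite.cast_ncard_eq, Nat.cast_inj] at hSr
    rw [isCircuit_iff_dep_forall_sdiff_singleton_indep]
    have hxS : x ∉ S := fun h => hS h rfl
    refine ⟨⟨?_, subset_univ _⟩, fun e he => ?_⟩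
    · rw [uniformWithColoop_indep_iff, sdiff_singleton_eq_self hxS]
      omega
    · rw [uniformWithColoop_indep_iff]
      have := ncard_sdiff_singleton_add_one he
      exact (ncard_le_ncard sdiff_subset).trans (by omega)

end Matroid

/-! ### Uniqueness and the main theorem -/

open Matroid

/-- Evaluating both properties at one relaxation suffices: `none` is a coloop added to the uniform
matroid of rank `k - 1` on `h` elements, lifted to the given universe. -/
theorem IsKLRelaxationPoly.unique {k h : ℕ} (hk : 1 ≤ k) (hkh : k ≤ h + 1) {p q : ℤ[X]}
    (hp : IsKLRelaxationPoly.{u} k h p) (hq : IsKLRelaxationPoly.{u} k h q) : p = q := by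
  have hcard : ({none}ᶜ : Set (Option (ULift.{u} (Fin h)))).ncard = h := by
    rw [ncard_compl, ncard_singleton, Nat.card_eq_fintype_card]
    simp
  have hr : k - 1 ≤ ({none}ᶜ : Set (Option (ULift.{u} (Fin h)))).ncard := by omega
  have hH := uniformWithColoop_isStressedHyperplane none hr
  have hrank := uniformWithColoop_eRank none hr
  rw [show k - 1 + 1 = k by omega] at hrank
  have henc : ({none}ᶜ : Set (Option (ULift.{u} (Fin h)))).encard = h := by
    rw [← (toFinite _).cast_ncard_eq, hcard]
  have h1 := hp _ _ _ hH hrank henc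
  have h2 := hq _ _ _ hH hrank henc
  exact add_left_cancel (h1.symm.trans h2)

theorem isKLRelaxationPoly_klRelaxPoly (k d : ℕ) :
    IsKLRelaxationPoly.{u} k (k + d) (klRelaxPoly d k) :=
  fun _ M _ H hH hk hh => klPoly_relax d k M H hH hk hh

/-- A hyperplane with fewer elements than the rank contains no new base, so the relaxation is the
matroid itself. -/
theorem isKLRelaxationPoly_zero (h : ℕ) : IsKLRelaxationPoly.{u} (h + 1) h 0 := by
  intro α M _ H hH hk hh
  rw [add_zero]
  refine klPoly_congr (ext_isBase rfl fun B _ => ?_)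
  rw [relax_isBase_iff, or_iff_left]
  rintro ⟨hBH, hB⟩
  have := encard_le_encard hBH
  rw [hB, hk, hh, Nat.cast_le] at this
  omega

theorem mainTheorem11 (k h : ℕ) (hk : 1 ≤ k) (hh : 1 ≤ h) (hkh : k ≤ h + 1) :
    (∃! p : ℤ[X], IsKLRelaxationPoly.{u} k h p) ∧
    ∀ p : ℤ[X], IsKLRelaxationPoly.{u} k h p →
      (2 ≤ k → p = ∑ i ∈ Finset.range ((k - 1) / 2 + 1),
        C (skytBar (h + 2 - k) i (k + 1 - 2 * i) : ℤ) * X ^ i) ∧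
      (k = 1 → p = 1) ∧
      (∀ i, 0 ≤ p.coeff i) ∧
      (k = 2 ∨ k = h + 1 → p = 0) ∧
      (k ≠ 2 → k ≤ h → p.degree = ((k - 1) / 2 : ℕ)) := by
  rcases Nat.lt_or_ge h k with hlt | hge
  · obtain rfl : k = h + 1 := by omega
    have h0 := isKLRelaxationPoly_zero.{u} h
    refine ⟨⟨0, h0, fun q hq => hq.unique hk hkh h0⟩, fun p hp => ?_⟩
    obtain rfl := hp.unique hk hkh h0
    -- The sum vanishes because the left column would have length `a = 1`, below 2. The value 1 in
    -- rank one causes no conflict: `1 ≤ h` excludes `k = 1` here.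
    refine ⟨fun _ => (Finset.sum_eq_zero fun i _ => ?_).symm, by omega, by simp, by simp, by omega⟩
    have : skytBar (h + 2 - (h + 1)) i (h + 1 + 1 - 2 * i) = 0 := by
      rw [skytBar, if_pos (by omega)]
    rw [this, Nat.cast_zero, C_0, zero_mul]
  · obtain ⟨d, rfl⟩ : ∃ d, h = k + d := ⟨h - k, by omega⟩
    have h0 := isKLRelaxationPoly_klRelaxPoly.{u} k d
    refine ⟨⟨_, h0, fun q hq => hq.unique hk hkh h0⟩, fun p hp => ?_⟩
    obtain rfl := hp.unique hk hkh h0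
    refine ⟨fun h2 => ?_, ?_, coeff_klRelaxPoly_nonneg d k, ?_, fun h2 _ => degree_klRelaxPoly hk h2⟩
    · rw [klRelaxPoly, if_neg (by omega), show k + d + 2 - k = d + 2 by omega]
    · rintro rfl
      rw [klRelaxPoly, if_pos rfl]
    · intro h2
      obtain rfl : k = 2 := by omega
      simp [klRelaxPoly, skytBar_zero]
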